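/- Let $S$ be a regular semigroup (every $x\in S$ has an inverse $x'$: $xx'x=x$, $x'xx'=x'$), and let $E$ be its set of idempotents. For $e,f\in E$ write $e\,\omega^l f$ if $ef=e$, $e\,\omega^r f$ if $fe=e$, $\omega=\omega^l\cap\omega^r$, $\mathscr L=\omega^l\cap(\omega^l)^{-1}$, $\mathscr R=\omega^r\cap(\omega^r)^{-1}$. The inductive groupoid $\mathcal G(S)$ has object set $E$; its morphisms $e\to f$ are the pairs $(x,x')$ of mutually inverse elements with $xx'=e$, $x'x=f$, and $(x,x')(y,y')=(xy,y'x')$. *Normal categories.* A category with subobjects is a small category $\mathcal C$ with a wide subcategory $\mathcal P$ of "inclusions" which is a strict preorder, consists of monomorphisms, and satisfies: $hg\in\mathcal P$ and $g\in\mathcal P$ imply $h\in\mathcal P$. A retraction is a morphism $q$ with $jq=1$ for some inclusion $j$ (composition is written from left to right). A normal cone with apex $d$ is a family $\gamma(c)\colon c\to d$ ($c\in v\mathcal C$) with $j\gamma(c')=\gamma(c)$ for every inclusion $j\colon c\to c'$ and with at least one component an isomorphism. $\mathcal C$ is normal if every morphism is a product $f=quj$ of a retraction, an isomorphism and an inclusion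 (then $f^\circ=qu$ depends only on $f$), every inclusion splits, and each object $c$ is the apex of a normal cone $\gamma$ with $\gamma(c)=1_c$. Normal cones are multiplied by $\gamma\cdot\sigma=\gamma*\sigma(c_\gamma)^\circ$, where $c_\gamma$ is the apex of $\gamma$ and $(\gamma*f^\circ)(a)=\gamma(a)f^\circ$. Put $H(\gamma;c)=\{\gamma*f^\circ: f\in\mathcal C(c_\gamma,c)\}$ and $H(\gamma;g)\colon\gamma*f^\circ\mapsto\gamma*(fg)^\circ$, and let $\eta_\gamma\colon H(\gamma;-)\to\mathcal C(c_\gamma,-)$, $\gamma*f^\circ\mapsto f$. The normal dual $N^*\mathcal C$ is the full subcategory of $[\mathcal C,\mathbf{Set}]$ on the functors $H(\gamma;-)$, its inclusions being the inclusions of subfunctors; $MH(\gamma;-)$ is the set of objects $c$ for which $\gamma(c)$ is an isomorphism. *Cross-connections.* A cross-connection $(\mathcal D,\mathcal C;\Gamma)$ of normal categories is a functor $\Gamma\colon\mathcal D\to N^*\mathcal C$ that is inclusion preserving, fully faithful, maps for each $d$ the full subcategory on the subobjects of $d$ isomorphically onto that on the subobjects of $\Gamma(d)$, and is such that every $c\in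 v\mathcal C$ lies in $M\Gamma(d)$ for some $d$. Let $E_\Gamma=\{(c,d): c\in M\Gamma(d)\}$, and for $(c,d)\in E_\Gamma$ let $\gamma(c,d)$ be the unique idempotent normal cone in $\mathcal C$ with apex $c$ and $H(\gamma(c,d);-)=\Gamma(d)$. The dual of $\Gamma$ is the cross-connection $\Delta\colon\mathcal C\to N^*\mathcal D$ such that, writing $\delta(c,d)$ for the corresponding idempotent cones of $\Delta$: $(d,c)\in E_\Delta\iff(c,d)\in E_\Gamma$; for $(c,d),(c',d')\in E_\Gamma$, $f\colon c\to c'$ and $g\colon d'\to d$, one has $\Delta(f)\,\eta_{\delta(c',d')}=\eta_{\delta(c,d)}\,\mathcal D(g,-)$ if and only if $\Gamma(g)\,\eta_{\gamma(c,d)}=\eta_{\gamma(c',d')}\,\mathcal C(f,-)$ (in this case $g=f^*$ is called the transpose of $f$); and $\delta(c,d)(d')=(\gamma(c',d')(c))^*$. A morphism from $(\mathcal D,\mathcal C;\Gamma)$ to $(\mathcal D',\mathcal C';\Gamma')$ is a pair of inclusion preserving functors $F\colon\mathcal C\to\mathcal C'$, $G\colon\mathcal D\to\mathcal D'$ such that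 (M1) $(c,d)\in E_\Gamma$ implies $(F(c),G(d))\in E_{\Gamma'}$ and $F(\gamma(c,d)(c'))=\gamma(F(c),G(d))(F(c'))$ for all $c'\in v\mathcal C$; (M2) if $(c,d),(c',d')\in E_\Gamma$ and $f^*\colon d'\to d$ is the transpose of $f\colon c\to c'$, then $G(f^*)=F(f)^*$. It is an isomorphism if it has an inverse morphism. *The cross-connection of $S$.* $\mathcal L_S$ is the category of the principal left ideals $Se$ ($e\in E$), with the morphisms $\rho(e,u,f)\colon Se\to Sf$, $x\mapsto xu$ ($u\in eSf$), and with the set inclusions $Se\subseteq Sf$ as inclusions. Dually, $\mathcal R_S$ is the category of the principal right ideals $eS$, with the morphisms $\lambda(e,u,f)\colon eS\to fS$, $x\mapsto ux$ ($u\in fSe$). With the cones $\rho^e(Sg)=\rho(g,ge,e)$ and $\lambda^e(gS)=\lambda(g,eg,e)$, the functor $\Gamma_S\colon\mathcal R_S\to N^*\mathcal L_S$ is given by $\Gamma_S(eS)=H(\rho^e;-)$, $\Gamma_S(\lambda(e,u,f))=\eta_{\rho^e}\,\mathcal L_S(\rho(f,u,e),-)\,\eta_{\rho^f}^{-1}$,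 and $\Delta_S\colon\mathcal L_S\to N^*\mathcal R_S$ is given dually by $\Delta_S(Se)=H(\lambda^e;-)$, $\Delta_S(\rho(e,u,f))=\eta_{\lambda^e}\,\mathcal R_S(\lambda(f,u,e),-)\,\eta_{\lambda^f}^{-1}$. *The cross-connection of $\mathcal G(S)$.* Let $\mathcal L_Q$ be the quiver with vertex set $E/\mathscr L$ whose arrows from the class $\overleftarrow e$ of $e$ to the class $\overleftarrow f$ of $f$ are the symbols $r(e,u,f)$ for which $u=e$ and $e\,\omega^l f$, or $u\in E$, $u\mathrel{\mathscr L}f$ and $u\,\omega\,e$, or $(u,u')\colon e\to f$ is a morphism of $\mathcal G(S)$ for some $u'$. Write the morphisms of the free category on $\mathcal L_Q$ as symbols $r(e,u,f)$ by means of $r(e,u,f)\,r(g,v,h)=r(e,uv,h)$ (for $f\mathrel{\mathscr L}g$) and $1_{\overleftarrow e}=r(e,e,e)$. The category $\mathcal L_G$ is the quotient of the free category by the relation $r(e,u,f)\sim r(g,v,h)\iff e\mathrel{\mathscr L}g,\ f\mathrel{\mathscr L}h,\ u=ev$; its inclusions are the morphisms $r(e,e,f)$ with $e\,\omega^l f$.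 It contains a morphism $r(e,u,f)$ for every $u\in eSf$. The category $\mathcal R_G$, with objects the classes $\overrightarrow e$ in $E/\mathscr R$ and morphisms $l(e,u,f)$ ($u\in fSe$), is obtained by the dual construction (from the opposite semigroup), a morphism $(x,x')\colon e\to f$ of $\mathcal G(S)$ giving the arrow $l(e,x',f)$. With the cones $r^e(\overleftarrow g)=r(g,ge,e)$ and $l^e(\overrightarrow g)=l(g,eg,e)$, the functors $\Gamma_G\colon\mathcal R_G\to N^*\mathcal L_G$ and $\Delta_G\colon\mathcal L_G\to N^*\mathcal R_G$ are given by $\Gamma_G(\overrightarrow e)=H(r^e;-)$, $\Gamma_G(l(e,u,f))=\eta_{r^e}\,\mathcal L_G(r(f,u,e),-)\,\eta_{r^f}^{-1}$, $\Delta_G(\overleftarrow e)=H(l^e;-)$ and $\Delta_G(r(e,u,f))=\eta_{l^e}\,\mathcal R_G(l(f,u,e),-)\,\eta_{l^f}^{-1}$. **Theorem.** $\mathcal L_G,\mathcal R_G,\mathcal L_S,\mathcal R_S$ are normal categories; $(\mathcal R_G,\mathcal L_G;\Gamma_G)$ and $(\mathcal R_S,\mathcal L_S;\Gamma_S)$ are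 cross-connections with duals $\Delta_G$ and $\Delta_S$; the functors $\mathfrak L\colon\mathcal L_G\to\mathcal L_S$, $\mathfrak L(\overleftarrow e)=Se$, $\mathfrak L(r(e,u,f))=\rho(e,u,f)$, and $\mathfrak R\colon\mathcal R_G\to\mathcal R_S$, $\mathfrak R(\overrightarrow e)=eS$, $\mathfrak R(l(e,u,f))=\lambda(e,u,f)$, are isomorphisms of normal categories; and $(\mathfrak L,\mathfrak R)$ is an isomorphism of cross-connections from $(\mathcal R_G,\mathcal L_G;\Gamma_G)$ onto $(\mathcal R_S,\mathcal L_S;\Gamma_S)$, that is, it satisfies (M1) and (M2) and has an inverse morphism of cross-connections. -/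

import Mathlib

open CategoryTheory

universe u v

namespace CrossConn

/-! ### Categories with subobjects, normal categories -/

/-- The data of a distinguished class `𝒫` of morphisms, the inclusions. -/
class Inclusions (C : Type u) [Category.{v} C] where
  incl : ∀ {a b : C}, (a ⟶ b) → Prop

open Inclusions (incl)

/-- `a ⊆ b`: there is an inclusion from `a` to `b`. -/
def Sub {C : Type u} [Category.{v} C] [Inclusions C] (a b : C) : Prop :=
  ∃ j : a ⟶ b, incl j

/-- `(C, 𝒫)` is a category with subobjects: the inclusions form a wide subcategory which is a
strict preorder, they are monomorphisms, and `h ≫ g ∈ 𝒫`, `g ∈ 𝒫` imply `h ∈ 𝒫`. -/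
class CategoryWithSubobjects (C : Type u) [Category.{v} C] [Inclusions C] : Prop where
  incl_id : ∀ a : C, incl (𝟙 a)
  incl_comp : ∀ {a b c : C} (f : a ⟶ b) (g : b ⟶ c), incl f → incl g → incl (f ≫ g)
  incl_unique : ∀ {a b : C} (f g : a ⟶ b), incl f → incl g → f = g
  incl_antisymm : ∀ {a b : C} (f : a ⟶ b) (g : b ⟶ a), incl f → incl g → a = b
  incl_mono : ∀ {a b : C} (f : a ⟶ b), incl f → Mono f
  incl_of_comp : ∀ {a b c : C} (h : a ⟶ b) (g : b ⟶ c), incl g → incl (h ≫ g) → incl h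

section

variable {C : Type u} [Category.{v} C] [Inclusions C]

/-- `q : c ⟶ c'` is a retraction: `c' ⊆ c` and `j(c', c) ≫ q = 𝟙`. -/
def IsRetraction {c c' : C} (q : c ⟶ c') : Prop :=
  ∃ j : c' ⟶ c, incl j ∧ j ≫ q = 𝟙 c'

/-- A normal factorization `f = q u j` of `f : c ⟶ d`: a retraction, an isomorphism, and an
inclusion. -/
structure NormalFactorization {c d : C} (f : c ⟶ d) where
  {c' : C}
  {d' : C}
  q : c ⟶ c'
  u : c' ⟶ d'
  j : d' ⟶ d
  retraction : IsRetraction q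
  iso : IsIso u
  inclusion : incl j
  fac : q ≫ u ≫ j = f

/-- A normal cone with apex `d`. -/
@[ext]
structure NormalCone (d : C) where
  comp : ∀ c : C, c ⟶ d
  incl_comp : ∀ {c c' : C} (j : c ⟶ c'), incl j → j ≫ comp c' = comp c
  exists_iso : ∃ c : C, IsIso (comp c)

end

/-- The set `TC` of all normal cones in `C`. -/
abbrev TC (C : Type u) [Category.{v} C] [Inclusions C] : Type (max u v) :=
  Σ d : C, NormalCone d

/-- Normal categories. -/
class NormalCategory (C : Type u) [Category.{v} C] [Inclusions C] : Prop
    extends CategoryWithSubobjects C where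
  normal_factorization : ∀ {c d : C} (f : c ⟶ d), Nonempty (NormalFactorization f)
  incl_splits : ∀ {c d : C} (j : c ⟶ d), incl j → ∃ q : d ⟶ c, j ≫ q = 𝟙 c
  exists_cone : ∀ c : C, ∃ γ : NormalCone c, γ.comp c = 𝟙 c

/-! ### The semigroup of normal cones, H-functors, the normal dual -/

section

variable {C : Type u} [Category.{v} C] [Inclusions C] [NormalCategory C]

/-- A chosen normal factorization of `f`.  (The object `im f` and the epimorphic component do not
depend on the choice.) -/
noncomputable def factor {c d : C} (f : c ⟶ d) : NormalFactorization f :=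
  (NormalCategory.normal_factorization f).some

/-- The codomain of the epimorphic component of `f`. -/
noncomputable abbrev im {c d : C} (f : c ⟶ d) : C := (factor f).d'

/-- The epimorphic component `f° = q u` of `f = q u j`. -/
noncomputable def epi {c d : C} (f : c ⟶ d) : c ⟶ im f := (factor f).q ≫ (factor f).u

/-- The inclusion part `j` of `f = q u j`. -/
noncomputable def imIncl {c d : C} (f : c ⟶ d) : im f ⟶ d := (factor f).j

theorem imIncl_incl {c d : C} (f : c ⟶ d) : incl (imIncl f) := (factor f).inclusion

theorem epi_imIncl {c d : C} (f : c ⟶ d) : epi f ≫ imIncl f = f := by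
  rw [epi, imIncl, Category.assoc]
  exact (factor f).fac

/-- A monomorphism is, up to an isomorphism, an inclusion. -/
theorem mono_factor {c d : C} (f : c ⟶ d) [Mono f] :
    ∃ (d' : C) (u : c ⟶ d') (j : d' ⟶ d), IsIso u ∧ incl j ∧ u ≫ j = f := by
  obtain ⟨F⟩ := NormalCategory.normal_factorization f
  obtain ⟨i, hi, hiq⟩ := F.retraction
  have := F.iso
  have : Mono F.q := by
    have := F.fac
    have : Mono (F.q ≫ F.u ≫ F.j) := by rw [this]; infer_instance
    exact mono_of_mono F.q (F.u ≫ F.j)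
  have : IsIso F.q := ⟨i, by
    rw [← cancel_mono F.q, Category.assoc, hiq, Category.comp_id, Category.id_comp], hiq⟩
  exact ⟨_, F.q ≫ F.u, F.j, inferInstance, F.inclusion, by simpa using F.fac⟩

/-- The normal cone `γ * f°` with apex `im f`, whose component at `a` is `γ(a) f°`. -/
noncomputable def star {c d : C} (γ : NormalCone c) (f : c ⟶ d) : NormalCone (im f) where
  comp a := γ.comp a ≫ epi f
  incl_comp j hj := by rw [← Category.assoc, γ.incl_comp j hj]
  exists_iso := by
    obtain ⟨a, ha⟩ := γ.exists_iso
    obtain ⟨i, hi, hiq⟩ := (factor f).retraction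
    have := (factor f).iso
    have := CategoryWithSubobjects.incl_mono i hi
    obtain ⟨b, w, k, hw, hk, hwk⟩ := mono_factor (i ≫ inv (γ.comp a))
    refine ⟨b, ?_⟩
    have h : γ.comp b ≫ epi f = inv w ≫ (factor f).u := by
      rw [← γ.incl_comp k hk, IsIso.eq_inv_comp]
      simp only [← Category.assoc, hwk]
      simp [epi, reassoc_of% hiq]
    rw [h]
    exact inferInstanceAs (IsIso (inv w ≫ (factor f).u))

/-- The product `γ · σ = γ * (σ(c_γ))°` of normal cones. -/
noncomputable instance : Mul (TC C) where
  mul γ σ := ⟨_, star γ.2 (σ.2.comp γ.1)⟩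

theorem star_comp_imIncl {c d : C} (γ : NormalCone c) (f : c ⟶ d) (a : C) :
    (star γ f).comp a ≫ imIncl f = γ.comp a ≫ f := by
  simp [star, epi_imIncl]

theorem NormalCone.cancel {C : Type u} [Category.{v} C] [Inclusions C] {c d : C} (γ : NormalCone c) (f g : c ⟶ d)
    (h : ∀ a, γ.comp a ≫ f = γ.comp a ≫ g) : f = g := by
  obtain ⟨a, ha⟩ := γ.exists_iso
  exact (cancel_epi (γ.comp a)).1 (h a)

/-- A normal cone is determined by its components, viewed in any larger object. -/
theorem cone_ext {c c' d : C} (σ : NormalCone c) (σ' : NormalCone c') (j : c ⟶ d) (j' : c' ⟶ d)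
    (hj : incl j) (hj' : incl j') (h : ∀ a, σ.comp a ≫ j = σ'.comp a ≫ j') :
    (⟨c, σ⟩ : TC C) = ⟨c', σ'⟩ := by
  have key : ∀ {c c' : C} (σ : NormalCone c) (σ' : NormalCone c') (j : c ⟶ d) (j' : c' ⟶ d),
      incl j → incl j' → (∀ a, σ.comp a ≫ j = σ'.comp a ≫ j') → Sub c c' := by
    intro c c' σ σ' j j' hj hj' h
    obtain ⟨a, ha⟩ := σ.exists_iso
    refine ⟨inv (σ.comp a) ≫ σ'.comp a, CategoryWithSubobjects.incl_of_comp _ j' hj' ?_⟩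
    rw [Category.assoc, ← h a, IsIso.inv_hom_id_assoc]
    exact hj
  obtain ⟨i, hi⟩ := key σ σ' j j' hj hj' h
  obtain ⟨i', hi'⟩ := key σ' σ j' j hj' hj (fun a => (h a).symm)
  obtain rfl := CategoryWithSubobjects.incl_antisymm i i' hi hi'
  obtain rfl := CategoryWithSubobjects.incl_unique j j' hj hj'
  have := CategoryWithSubobjects.incl_mono j hj
  have : σ = σ' := NormalCone.ext (funext fun a => (cancel_mono j).1 (h a))
  rw [this]

theorem star_injective {c d : C} (γ : NormalCone c) :
    Function.Injective fun f : c ⟶ d => (⟨im f, star γ f⟩ : TC C) := by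
  intro f g h
  have key : ∀ (σ τ : TC C) (i : σ.1 ⟶ d) (j : τ.1 ⟶ d), σ = τ → incl i → incl j →
      ∀ a, σ.2.comp a ≫ i = τ.2.comp a ≫ j := by
    rintro σ τ i j rfl hi hj a
    rw [CategoryWithSubobjects.incl_unique i j hi hj]
  refine γ.cancel f g fun a => ?_
  rw [← star_comp_imIncl γ f, ← star_comp_imIncl γ g]
  exact key ⟨_, star γ f⟩ ⟨_, star γ g⟩ _ _ h (imIncl_incl f) (imIncl_incl g) a

end

/-- A functor from `C` to sets all of whose values are subsets of `U`. -/
@[ext]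
structure SubsetFunctor (C : Type u) [Category.{v} C] (U : Type (max u v)) where
  obj : C → Set U
  map : ∀ {c d : C}, (c ⟶ d) → obj c → obj d
  map_id : ∀ (c : C) (x : obj c), map (𝟙 c) x = x
  map_comp : ∀ {c d e : C} (f : c ⟶ d) (g : d ⟶ e) (x : obj c), map (f ≫ g) x = map g (map f x)

theorem SubsetFunctor.ext_of {C : Type u} [Category.{v} C] {U : Type (max u v)}
    {F G : SubsetFunctor C U} (h : ∀ c, F.obj c = G.obj c)
    (h' : ∀ {c d : C} (g : c ⟶ d) (x : U) (hx : x ∈ F.obj c) (hx' : x ∈ G.obj c),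
      (F.map g ⟨x, hx⟩ : U) = G.map g ⟨x, hx'⟩) : F = G := by
  obtain ⟨o, m, _, _⟩ := F
  obtain ⟨o', m', _, _⟩ := G
  obtain rfl : o = o' := funext h
  have : @m = @m' := by
    funext c d g x
    exact Subtype.ext (h' g x.1 x.2 x.2)
  subst this
  rfl

/-- The underlying functor from `C` to the category of sets. -/
def SubsetFunctor.toFunctor {C : Type u} [Category.{v} C] {U : Type (max u v)}
    (F : SubsetFunctor C U) : C ⥤ Type (max u v) where
  obj c := F.obj c
  map f := TypeCat.ofHom (F.map f)
  map_id c := by ext x; simp [F.map_id]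
  map_comp f g := by ext x; simp [F.map_comp]

section

variable {C : Type u} [Category.{u} C] [Inclusions C] [NormalCategory C]

/-- The set `H(γ; c) = {γ * f° : f ∈ C(c_γ, c)}`. -/
def Hset {a : C} (γ : NormalCone a) (c : C) : Set (TC C) :=
  Set.range fun f : a ⟶ c => (⟨im f, star γ f⟩ : TC C)

/-- The bijection `γ * f° ↔ f` between `H(γ; c)` and `C(c_γ, c)`. -/
noncomputable def Hequiv {a : C} (γ : NormalCone a) (c : C) : (a ⟶ c) ≃ Hset γ c :=
  Equiv.ofInjective _ (star_injective γ)

/-- The H-functor `H(γ; -)`, with `H(γ; g) : γ * f° ↦ γ * (f g)°`. -/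
noncomputable def H {a : C} (γ : NormalCone a) : SubsetFunctor C (TC C) where
  obj c := Hset γ c
  map {c d} g x := Hequiv γ d ((Hequiv γ c).symm x ≫ g)
  map_id c x := by simp
  map_comp f g x := by simp

theorem H_map_star {a : C} (γ : NormalCone a) {c d : C} (f : a ⟶ c) (g : c ⟶ d)
    (hx : (⟨im f, star γ f⟩ : TC C) ∈ (H γ).obj c) :
    (((H γ).map g ⟨_, hx⟩ : (H γ).obj d) : TC C) = ⟨im (f ≫ g), star γ (f ≫ g)⟩ := by
  have : (⟨_, hx⟩ : Hset γ c) = Hequiv γ c f := rfl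
  change ((Hequiv γ d ((Hequiv γ c).symm ⟨_, hx⟩ ≫ g) : Hset γ d) : TC C) = _
  rw [this, Equiv.symm_apply_apply]
  rfl

/-- Cones which differ by morphisms of their apices have the same H-functor. -/
theorem H_eq_of {a a' : C} (γ : NormalCone a) (γ' : NormalCone a') (θ : a ⟶ a') (θ' : a' ⟶ a)
    (h : ∀ x, γ'.comp x = γ.comp x ≫ θ) (h' : ∀ x, γ.comp x = γ'.comp x ≫ θ') : H γ = H γ' := by
  have key : ∀ {a a' : C} (γ : NormalCone a) (γ' : NormalCone a') (θ' : a' ⟶ a),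
      (∀ x, γ.comp x = γ'.comp x ≫ θ') → ∀ {c : C} (f : a ⟶ c),
      (⟨im f, star γ f⟩ : TC C) = ⟨im (θ' ≫ f), star γ' (θ' ≫ f)⟩ := by
    intro a a' γ γ' θ' h' c f
    refine cone_ext _ _ (imIncl _) (imIncl _) (imIncl_incl _) (imIncl_incl _) fun x => ?_
    rw [star_comp_imIncl, star_comp_imIncl, h', Category.assoc]
  refine SubsetFunctor.ext_of (fun c => ?_) ?_
  · ext σ
    constructor
    · rintro ⟨f, rfl⟩
      exact ⟨_, (key γ γ' θ' h' f).symm⟩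
    · rintro ⟨f, rfl⟩
      exact ⟨_, (key γ' γ θ h f).symm⟩
  · rintro c d g _ ⟨f, rfl⟩ hx'
    have e := key γ γ' θ' h' f
    have hm : ∀ (x y : TC C) (hx : x ∈ (H γ').obj c) (hy : y ∈ (H γ').obj c), x = y →
        ((H γ').map g ⟨x, hx⟩ : TC C) = (H γ').map g ⟨y, hy⟩ := by
      rintro x y hx hy rfl
      rfl
    refine (H_map_star γ f g _).trans (Eq.trans ?_ (hm _ _ hx' ⟨_, rfl⟩ e).symm)
    refine Eq.trans ?_ (H_map_star γ' (θ' ≫ f) g _).symm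
    rw [key γ γ' θ' h' (f ≫ g), Category.assoc]

/-- The natural isomorphism `η_γ : H(γ; -) ⟶ C(c_γ, -)`, `γ * f° ↦ f`. -/
noncomputable def eta {a : C} (γ : NormalCone a) :
    (H γ).toFunctor ≅ coyoneda.obj (Opposite.op a) :=
  NatIso.ofComponents (fun c => (Hequiv γ c).symm.toIso) (by
    intro c d g
    ext x
    exact (Hequiv γ d).symm_apply_apply _)

variable (C) in
/-- The normal dual `N*C`: the full subcategory of `[C, Set]` on the H-functors. -/
@[ext]
structure NormalDual : Type u where
  fn : SubsetFunctor C (TC C)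
  exists_eq : ∃ (a : C) (γ : NormalCone a), fn = H γ

/-- The morphisms of the normal dual are the natural transformations. -/
@[ext]
structure NormalDual.Hom (F G : NormalDual C) where
  nat : F.fn.toFunctor ⟶ G.fn.toFunctor

instance : Category.{u} (NormalDual C) where
  Hom F G := NormalDual.Hom F G
  id F := ⟨𝟙 F.fn.toFunctor⟩
  comp f g := ⟨f.nat ≫ g.nat⟩

/-- The object `H(γ; -)` of the normal dual. -/
noncomputable abbrev NormalDual.of {a : C} (γ : NormalCone a) : NormalDual C := ⟨H γ, a, γ, rfl⟩

/-- The component at `c` of a morphism of the normal dual, as a function. -/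
def NormalDual.apply {F G : NormalDual C} (m : F ⟶ G) (c : C) (x : F.fn.obj c) : G.fn.obj c :=
  (m.nat.app c).hom.toFun x

/-- The inclusions of the normal dual are the inclusions of subfunctors. -/
instance : Inclusions (NormalDual C) where
  incl {F _} m := ∀ (c : C) (x : F.fn.obj c),
    (NormalDual.apply m c x : TC C) = x

/-- The M-set of an H-functor `H(γ; -)`: the objects `c` for which `γ(c)` is an isomorphism. -/
def MSet (F : NormalDual C) : Set C :=
  {c | ∃ (a : C) (γ : NormalCone a), F = NormalDual.of γ ∧ IsIso (γ.comp c)}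

end

/-! ### Cross-connections, duals, transposes, morphisms -/

section

variable {C D : Type u} [Category.{u} C] [Inclusions C] [Category.{u} D] [Inclusions D]

/-- `F` maps inclusions to inclusions. -/
def InclusionPreserving (F : C ⥤ D) : Prop :=
  ∀ {a b : C} (j : a ⟶ b), incl j → incl (F.map j)

/-- `F` is inclusion preserving, fully faithful, and for each `c` restricts to an isomorphism of
the ideal `⟨c⟩` onto the ideal `⟨F c⟩`.  Ideals are full subcategories, so for fully faithful `F`
the last condition is bijectivity on the objects of the ideals. -/
structure IsLocalIsomorphism (F : C ⥤ D) : Prop where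
  inclusionPreserving : InclusionPreserving F
  full : F.Full
  faithful : F.Faithful
  ideal_bijOn : ∀ c : C, Set.BijOn F.obj {c' | Sub c' c} {d | Sub d (F.obj c)}

/-- `F` is an isomorphism of normal categories. -/
structure IsNormalCategoryIso (F : C ⥤ D) : Prop where
  obj_bijective : Function.Bijective F.obj
  full : F.Full
  faithful : F.Faithful
  incl_iff : ∀ {a b : C} (j : a ⟶ b), incl (F.map j) ↔ incl j

end

section

variable {C D : Type u} [Category.{u} C] [Inclusions C] [NormalCategory C] [Category.{u} D]

/-- `(c, d) ∈ E_Γ`, that is, `c ∈ MΓ(d)`. -/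
def EGamma (Γ : D ⥤ NormalDual C) (c : C) (d : D) : Prop := c ∈ MSet (Γ.obj d)

/-- `(D, C; Γ)` is a cross-connection. -/
structure IsCrossConnection [Inclusions D] (Γ : D ⥤ NormalDual C) : Prop where
  localIso : IsLocalIsomorphism Γ
  exists_mem : ∀ c : C, ∃ d : D, EGamma Γ c d

theorem exists_idempotent_cone {F : NormalDual C} {c : C} (h : c ∈ MSet F) :
    ∃ ε : NormalCone c, IsIdempotentElem (⟨c, ε⟩ : TC C) ∧ F = NormalDual.of ε := by
  obtain ⟨a, γ, rfl, hc⟩ := h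
  let ε : NormalCone c :=
    { comp := fun x => γ.comp x ≫ inv (γ.comp c)
      incl_comp := fun j hj => by rw [← Category.assoc, γ.incl_comp j hj]
      exists_iso := ⟨c, by simp only [IsIso.hom_inv_id]; infer_instance⟩ }
  refine ⟨ε, ?_, ?_⟩
  · change (⟨_, star ε (ε.comp c)⟩ : TC C) = ⟨c, ε⟩
    refine cone_ext _ _ (imIncl _) (𝟙 c) (imIncl_incl _) (CategoryWithSubobjects.incl_id c)
      fun a => ?_
    rw [star_comp_imIncl]
    simp [ε]
  · exact NormalDual.ext (H_eq_of γ ε (inv (γ.comp c)) (γ.comp c) (fun _ => rfl)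
      (fun x => by simp [ε]))

/-- For `(c, d) ∈ E_Γ`, the (unique) idempotent cone `γ(c, d) ∈ TC` with apex `c` and
`H(γ(c, d); -) = Γ(d)`. -/
noncomputable def gammaCone {Γ : D ⥤ NormalDual C} {c : C} {d : D} (h : EGamma Γ c d) :
    NormalCone c :=
  (exists_idempotent_cone h).choose

theorem gammaCone_spec {Γ : D ⥤ NormalDual C} {c : C} {d : D} (h : EGamma Γ c d) :
    IsIdempotentElem (⟨c, gammaCone h⟩ : TC C) ∧ Γ.obj d = NormalDual.of (gammaCone h) :=
  (exists_idempotent_cone h).choose_spec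

/-- The natural isomorphism `η_{γ(c, d)} : Γ(d) ⟶ C(c, -)`. -/
noncomputable def etaGamma {Γ : D ⥤ NormalDual C} {c : C} {d : D} (h : EGamma Γ c d) :
    (Γ.obj d).fn.toFunctor ≅ coyoneda.obj (Opposite.op c) :=
  eqToIso (by rw [(gammaCone_spec h).2]) ≪≫ eta (gammaCone h)

/-- For `(c, d), (c', d') ∈ E_Γ`, `g : d ⟶ d'` and `f : c' ⟶ c`, the square with sides
`Γ(g) : Γ(d) ⟶ Γ(d')`, `C(f, -) : C(c, -) ⟶ C(c', -)`, `η_{γ(c, d)} : Γ(d) ⟶ C(c, -)` and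
`η_{γ(c', d')} : Γ(d') ⟶ C(c', -)` commutes. -/
def CommSquare (Γ : D ⥤ NormalDual C) {c c' : C} {d d' : D} (h : EGamma Γ c d)
    (h' : EGamma Γ c' d') (g : d ⟶ d') (f : c' ⟶ c) : Prop :=
  (Γ.map g).nat ≫ (etaGamma h').hom = (etaGamma h).hom ≫ coyoneda.map f.op

variable [Inclusions D] [NormalCategory D]

/-- `Δ : C ⥤ N*D` is the dual of the cross-connection `Γ : D ⥤ N*C`: it is a cross-connection
with `(d, c) ∈ E_Δ ↔ (c, d) ∈ E_Γ`; a pair of morphisms `f : c ⟶ c'`, `g : d' ⟶ d` makes the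
square of `Γ` commute if and only if it makes the square of `Δ` commute; and
the component at `d'` of the idempotent cone `δ(c, d) ∈ TD` corresponds in this way to the
component at `c` of the idempotent cone `γ(c', d') ∈ TC`. These conditions determine `Δ`. -/
structure IsDual (Γ : D ⥤ NormalDual C) (Δ : C ⥤ NormalDual D) : Prop where
  isCrossConnection : IsCrossConnection Δ
  mem_iff : ∀ (c : C) (d : D), EGamma Δ d c ↔ EGamma Γ c d
  square_iff : ∀ {c c' : C} {d d' : D} (h : EGamma Γ c d) (h' : EGamma Γ c' d')
    (k : EGamma Δ d c) (k' : EGamma Δ d' c') (f : c ⟶ c') (g : d' ⟶ d),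
    CommSquare Δ k k' f g ↔ CommSquare Γ h' h g f
  cone_comp : ∀ {c c' : C} {d d' : D} (h : EGamma Γ c d) (h' : EGamma Γ c' d')
    (k : EGamma Δ d c),
    CommSquare Γ h' h ((gammaCone k).comp d') ((gammaCone h').comp c)

/-- For `(c, d), (c', d') ∈ E_Γ`, the morphism `g : d' ⟶ d` is the transpose `f*` of
`f : c ⟶ c'`: the square formed by `Δ(f)`, `D(g, -)`, `η_{δ(c, d)}` and `η_{δ(c', d')}`
commutes, where `Δ` is the dual of `Γ`. -/
def IsTranspose (Δ : C ⥤ NormalDual D) {c c' : C} {d d' : D} (f : c ⟶ c') (g : d' ⟶ d) : Prop :=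
  ∃ (k : EGamma Δ d c) (k' : EGamma Δ d' c'), CommSquare Δ k k' f g

end

section

variable {C D C' D' : Type u}
  [Category.{u} C] [Inclusions C] [NormalCategory C]
  [Category.{u} D] [Inclusions D] [NormalCategory D]
  [Category.{u} C'] [Inclusions C'] [NormalCategory C']
  [Category.{u} D'] [Inclusions D'] [NormalCategory D']

/-- `(F, G)` is a morphism from the cross-connection `(D, C; Γ)` with dual `Δ` to the
cross-connection `(D', C'; Γ')` with dual `Δ'`. -/
structure IsCrossConnectionMorphism (Γ : D ⥤ NormalDual C) (Δ : C ⥤ NormalDual D)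
    (Γ' : D' ⥤ NormalDual C') (Δ' : C' ⥤ NormalDual D') (F : C ⥤ C') (G : D ⥤ D') : Prop where
  inclusionPreserving_left : InclusionPreserving F
  inclusionPreserving_right : InclusionPreserving G
  /-- (M1), first part -/
  map_mem : ∀ {c : C} {d : D}, EGamma Γ c d → EGamma Γ' (F.obj c) (G.obj d)
  /-- (M1), second part -/
  map_cone : ∀ {c : C} {d : D} (h : EGamma Γ c d) (c' : C),
    F.map ((gammaCone h).comp c') = (gammaCone (map_mem h)).comp (F.obj c')
  /-- (M2) -/
  map_transpose : ∀ {c c' : C} {d d' : D}, EGamma Γ c d → EGamma Γ c' d' →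
    ∀ (f : c ⟶ c') (g : d' ⟶ d), IsTranspose Δ f g → IsTranspose Δ' (F.map f) (G.map g)

/-- `(F, G)` is an isomorphism of cross-connections: it is a morphism which has an inverse
morphism. -/
def IsCrossConnectionIso (Γ : D ⥤ NormalDual C) (Δ : C ⥤ NormalDual D)
    (Γ' : D' ⥤ NormalDual C') (Δ' : C' ⥤ NormalDual D') (F : C ⥤ C') (G : D ⥤ D') : Prop :=
  IsCrossConnectionMorphism Γ Δ Γ' Δ' F G ∧
    ∃ (F' : C' ⥤ C) (G' : D' ⥤ D), IsCrossConnectionMorphism Γ' Δ' Γ Δ F' G' ∧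
      F ⋙ F' = 𝟭 C ∧ F' ⋙ F = 𝟭 C' ∧ G ⋙ G' = 𝟭 D ∧ G' ⋙ G = 𝟭 D'

end

/-! ### Regular semigroups and the inductive groupoid -/

/-- Every element of the semigroup has an inverse. -/
class IsRegularSemigroup (S : Type u) [Semigroup S] : Prop where
  exists_inverse : ∀ a : S, ∃ b : S, a * b * a = a ∧ b * a * b = b

instance (S : Type u) [Semigroup S] [IsRegularSemigroup S] : IsRegularSemigroup Sᵐᵒᵖ where
  exists_inverse a := by
    obtain ⟨b, h₁, h₂⟩ := IsRegularSemigroup.exists_inverse a.unop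
    refine ⟨MulOpposite.op b, MulOpposite.unop_injective ?_, MulOpposite.unop_injective ?_⟩
    · simpa [mul_assoc] using h₁
    · simpa [mul_assoc] using h₂

/-- The set `E(S)` of idempotents. -/
abbrev Idem (S : Type u) [Semigroup S] : Type u := {e : S // e * e = e}

section

variable {S : Type u} [Semigroup S]

/-- `e ω^l f`, that is, `e f = e`. -/
def OmegaL (e f : Idem S) : Prop := (e : S) * f = e

/-- `e ω^r f`, that is, `f e = e`. -/
def OmegaR (e f : Idem S) : Prop := (f : S) * e = e

/-- `e ω f`: the natural partial order on `E(S)`. -/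
def Omega (e f : Idem S) : Prop := OmegaL e f ∧ OmegaR e f

/-- Green's relation `ℒ` on `E(S)`. -/
def GreenL (e f : Idem S) : Prop := OmegaL e f ∧ OmegaL f e

/-- `u ∈ e S f`. -/
def Between (e : Idem S) (u : S) (f : Idem S) : Prop := ∃ s : S, u = e * s * f

theorem between_iff {e : Idem S} {u : S} {f : Idem S} :
    Between e u f ↔ (e : S) * u = u ∧ u * f = u := by
  constructor
  · rintro ⟨s, rfl⟩
    exact ⟨by rw [← mul_assoc, ← mul_assoc, e.2], by rw [mul_assoc, f.2]⟩
  · rintro ⟨h₁, h₂⟩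
    exact ⟨u, by rw [h₁, h₂]⟩

theorem GreenL.trans {e f g : Idem S} (h : GreenL e f) (h' : GreenL f g) : GreenL e g := by
  obtain ⟨h₁, h₂⟩ := h
  obtain ⟨h₃, h₄⟩ := h'
  unfold OmegaL at *
  refine ⟨?_, ?_⟩ <;> unfold OmegaL
  · rw [← h₁, mul_assoc, h₃]
  · rw [← h₄, mul_assoc, h₂]

variable (S) in
/-- Green's relation `ℒ` on `E(S)` as an equivalence relation. -/
def setoidL : Setoid (Idem S) where
  r := GreenL
  iseqv := ⟨fun e => ⟨e.2, e.2⟩, fun h => ⟨h.2, h.1⟩, GreenL.trans⟩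

variable (S) in
/-- The set `E/ℒ`. -/
abbrev EModL : Type u := Quotient (setoidL S)

/-- The canonical image of `e` in `E/ℒ`. -/
abbrev toEModL (e : Idem S) : EModL S := Quotient.mk (setoidL S) e

theorem toEModL_eq {e f : Idem S} : toEModL e = toEModL f ↔ GreenL e f :=
  Quotient.eq (r := setoidL S)

/-- A morphism `(x, x')` from `e = x x'` to `f = x' x` of the groupoid `𝒢(S)`: `x'` is an
inverse of `x`. -/
@[ext]
structure GHom (e f : Idem S) where
  x : S
  x' : S
  mul_mul : x * x' * x = x
  mul_mul' : x' * x * x' = x'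
  dom : x * x' = e
  cod : x' * x = f

variable (S) in
/-- The groupoid `𝒢(S)` of the regular semigroup `S`; its set of objects is `E(S)`. Of the
structure which makes it an inductive groupoid, the constructions below use the biordered set
`E(S)`, through `ω^l`, `ω^r` and `ω`. -/
structure IndGroupoid : Type u where
  as : Idem S

instance : Groupoid (IndGroupoid S) where
  Hom e f := GHom e.as f.as
  id e := ⟨e.as, e.as, by rw [e.as.2, e.as.2], by rw [e.as.2, e.as.2], e.as.2, e.as.2⟩
  comp {e f g} a b :=
    have h₁ : a.x * b.x * (b.x' * a.x') = e.as := by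
      rw [mul_assoc, ← mul_assoc b.x, b.dom, ← a.cod, ← mul_assoc, ← mul_assoc, a.mul_mul, a.dom]
    have h₂ : b.x' * a.x' * (a.x * b.x) = g.as := by
      rw [mul_assoc, ← mul_assoc a.x', a.cod, ← b.dom, ← mul_assoc, ← mul_assoc, b.mul_mul', b.cod]
    ⟨a.x * b.x, b.x' * a.x',
      by rw [h₁, ← a.dom, ← mul_assoc, a.mul_mul],
      by rw [h₂, ← b.cod, ← mul_assoc, b.mul_mul'], h₁, h₂⟩
  id_comp a := GHom.ext ((congrArg (· * a.x) a.dom).symm.trans a.mul_mul)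
    ((congrArg (a.x' * ·) a.dom).symm.trans ((mul_assoc _ _ _).symm.trans a.mul_mul'))
  comp_id a := GHom.ext ((congrArg (a.x * ·) a.cod).symm.trans
    ((mul_assoc _ _ _).symm.trans a.mul_mul)) ((congrArg (· * a.x') a.cod).symm.trans a.mul_mul')
  assoc a b c := GHom.ext (mul_assoc _ _ _) (mul_assoc _ _ _).symm
  inv a := ⟨a.x', a.x, a.mul_mul', a.mul_mul, a.cod, a.dom⟩
  inv_comp a := GHom.ext a.cod a.cod
  comp_inv a := GHom.ext a.dom a.dom

end

/-! ### The category `ℒ_S` of principal left ideals -/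

section

variable {S : Type u} [Semigroup S]

/-- The principal left ideal `S e`. -/
def leftIdeal (e : Idem S) : Set S := {x | ∃ s : S, x = s * e}

theorem mem_leftIdeal {e : Idem S} {x : S} : x ∈ leftIdeal e ↔ x * e = x :=
  ⟨by rintro ⟨s, rfl⟩; rw [mul_assoc, e.2], fun h => ⟨x, h.symm⟩⟩

theorem leftIdeal_eq {e f : Idem S} : leftIdeal e = leftIdeal f ↔ GreenL e f := by
  constructor
  · intro h
    exact ⟨mem_leftIdeal.1 (h ▸ mem_leftIdeal.2 e.2), mem_leftIdeal.1 (h ▸ mem_leftIdeal.2 f.2)⟩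
  · rintro ⟨h₁, h₂⟩
    unfold OmegaL at h₁ h₂
    ext x
    rw [mem_leftIdeal, mem_leftIdeal]
    constructor
    · intro h
      rw [← h, mul_assoc, h₁]
    · intro h
      rw [← h, mul_assoc, h₂]

variable (S) in
/-- The objects of `ℒ_S`: the principal left ideals `S e`, `e ∈ E(S)`. -/
structure LS : Type u where
  carrier : Set S
  exists_idem : ∃ e : Idem S, leftIdeal e = carrier

/-- The object `S e` of `ℒ_S`. -/
def LS.of (e : Idem S) : LS S := ⟨leftIdeal e, e, rfl⟩

/-- The morphisms of `ℒ_S`: the partial right translations `ρ(e, u, f) : S e → S f`, `x ↦ x u`,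
with `u ∈ e S f`. -/
@[ext]
structure LS.Hom (A B : LS S) where
  toFun : A.carrier → B.carrier
  exists_eq : ∃ (e : Idem S) (u : S) (f : Idem S), leftIdeal e = A.carrier ∧
    leftIdeal f = B.carrier ∧ Between e u f ∧ ∀ x, (toFun x : S) = x * u

instance : Category.{u} (LS S) where
  Hom A B := LS.Hom A B
  id A := ⟨id, by
    obtain ⟨e, he⟩ := A.exists_idem
    exact ⟨e, e, e, he, he, ⟨e, by rw [e.2, e.2]⟩,
      fun x => (mem_leftIdeal.1 (he.symm.subset x.2)).symm⟩⟩
  comp φ ψ := ⟨ψ.toFun ∘ φ.toFun, by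
    obtain ⟨e, u, f, he, hf, hu, hφ⟩ := φ.exists_eq
    obtain ⟨g, v, h, hg, hh, hv, hψ⟩ := ψ.exists_eq
    refine ⟨e, u * v, h, he, hh, between_iff.2 ⟨?_, ?_⟩, fun x => ?_⟩
    · rw [← mul_assoc, (between_iff.1 hu).1]
    · rw [mul_assoc, (between_iff.1 hv).2]
    · rw [Function.comp_apply, hψ, hφ, mul_assoc]⟩

/-- The inclusions of `ℒ_S` are the inclusions `S e ⊆ S f` of sets. -/
instance : Inclusions (LS S) where
  incl {A _} φ := ∀ x : A.carrier, (LS.Hom.toFun φ x : S) = x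

/-- The morphism `ρ(e, u, f)`. -/
def LS.rho {A B : LS S} (e : Idem S) (u : S) (f : Idem S) (he : LS.of e = A) (hf : LS.of f = B)
    (hu : Between e u f) : A ⟶ B :=
  ⟨fun x => ⟨x * u, by
    subst hf
    exact mem_leftIdeal.2 (by rw [mul_assoc, (between_iff.1 hu).2])⟩,
    e, u, f, congrArg LS.carrier he, congrArg LS.carrier hf, hu, fun _ => rfl⟩

theorem LS.hom_ext {A B : LS S} {φ ψ : A ⟶ B}
    (h : ∀ x : A.carrier, (LS.Hom.toFun φ x : S) = LS.Hom.toFun ψ x) : φ = ψ :=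
  LS.Hom.ext (funext fun x => Subtype.ext (h x))

variable (S) in
/-- The category `ℛ_S` of principal right ideals of `S`, that is, the category of principal left
ideals of the opposite semigroup. The morphism `λ(e, u, f)`, `u ∈ f S e`, from `e S` to `f S` is
the morphism `ρ(e, u, f)` of the opposite semigroup. -/
abbrev RS : Type u := LS Sᵐᵒᵖ

end

/-! ### The category `ℒ_G` built from the inductive groupoid -/

section

variable {S : Type u} [Semigroup S]

/-- `r(e, u, f)` is a morphism `j(e, f) = r(e, e, f)` of `𝒫_L`: `e ω^l f` and `u = e`. -/
def InPL (e : Idem S) (u : S) (f : Idem S) : Prop := OmegaL e f ∧ u = e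

/-- `r(e, u, f)` is a morphism of `𝒬_L`: `u ∈ E(L_f) ∩ ω(e)`. -/
def InQL (e : Idem S) (u : S) (f : Idem S) : Prop :=
  ∃ g : Idem S, u = g ∧ GreenL g f ∧ Omega g e

/-- `r(e, u, f)` is a morphism of `𝒢_L`: there is a morphism `(u, u')` from `e` to `f` in the
inductive groupoid. -/
def InGL (e : Idem S) (u : S) (f : Idem S) : Prop :=
  ∃ a : (⟨e⟩ : IndGroupoid S) ⟶ ⟨f⟩, GHom.x a = u

/-- The morphisms `r(e, u, f)` from the class of `e` to the class of `f` of the quiver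
`ℒ_Q = 𝒫_L ∪ 𝒬_L ∪ 𝒢_L`. -/
structure LQEdge (a b : EModL S) where
  e : Idem S
  u : S
  f : Idem S
  dom : toEModL e = a
  cod : toEModL f = b
  mem : InPL e u f ∨ InQL e u f ∨ InGL e u f

instance : Quiver (EModL S) where
  Hom a b := LQEdge a b

/-- `LQLabel p e u f`: the morphism `p` of the free category on `ℒ_Q` is written `r(e, u, f)`,
according to the composition `r(e, u, f) r(g, v, h) = r(e, u v, h)`, where the identity at the
class of `e` is `r(e, e, e)`. -/
inductive LQLabel : {a b : EModL S} → Quiver.Path a b → Idem S → S → Idem S → Prop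
  | nil {a : EModL S} (e : Idem S) (he : toEModL e = a) :
      LQLabel (Quiver.Path.nil : Quiver.Path a a) e e e
  | cons {a b c : EModL S} {p : Quiver.Path a b} {e : Idem S} {u : S} {f : Idem S}
      (h : LQLabel p e u f) (r : LQEdge b c) : LQLabel (Quiver.Path.cons p r) e (u * r.u) r.f

variable (S) in
/-- The relation `∼` on the free category: `r(e, u, f) ∼ r(g, v, h)` if and only if `e ℒ g`,
`f ℒ h` and `u = e v`. -/
def LQRel : HomRel (Paths (EModL S)) := fun _ _ p q =>
  ∃ (e : Idem S) (u : S) (f g : Idem S) (v : S) (h : Idem S),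
    LQLabel p e u f ∧ LQLabel q g v h ∧ GreenL e g ∧ GreenL f h ∧ u = e * v

variable (S) in
/-- The category `ℒ_G`: the quotient by `∼` of the free category on the quiver `ℒ_Q`. -/
abbrev LG : Type u := CategoryTheory.Quotient (LQRel S)

/-- The object of `ℒ_G` given by `e`. -/
def LG.of (e : Idem S) : LG S := ⟨toEModL e⟩

/-- The class in `ℒ_G` of a path in the quiver `ℒ_Q`. -/
def LG.ofPath {a b : LG S} (p : Quiver.Path (V := EModL S) a.as b.as) : a ⟶ b :=
  (CategoryTheory.Quotient.functor (LQRel S)).map (X := a.as) (Y := b.as) p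

/-- The inclusions of `ℒ_G` are the (classes of) morphisms of `𝒫_L`. -/
instance : Inclusions (LG S) where
  incl {a b} m := ∃ r : LQEdge a.as b.as, InPL r.e r.u r.f ∧
    m = LG.ofPath (Quiver.Path.nil.cons r)

variable (S) in
/-- The category `ℛ_G`, obtained by the dual construction, that is, from the opposite semigroup.
The morphism `l(e, u, f)`, `u ∈ f S e`, is the morphism `r(e, u, f)` of the opposite semigroup;
a morphism `(x, x')` from `e` to `f` in the inductive groupoid of `S` is a morphism `(x', x)` from
`e` to `f` in the one of the opposite semigroup and gives the morphism `l(e, x', f)`. -/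
abbrev RG : Type u := LG Sᵐᵒᵖ

theorem LQEdge.between {a b : EModL S} (r : LQEdge a b) : Between r.e r.u r.f := by
  obtain ⟨e, u, f, _, _, h⟩ := r
  rw [between_iff]
  rcases h with ⟨h, rfl⟩ | ⟨g, rfl, h, h'⟩ | ⟨a, rfl⟩
  · exact ⟨e.2, h⟩
  · exact ⟨h'.2, h.1⟩
  · refine ⟨?_, ?_⟩
    · exact (congrArg (· * GHom.x a) (GHom.dom a)).symm.trans (GHom.mul_mul a)
    · exact (congrArg (GHom.x a * ·) (GHom.cod a)).symm.trans
        ((mul_assoc _ _ _).symm.trans (GHom.mul_mul a))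

theorem LQLabel.spec {a b : EModL S} {p : Quiver.Path a b} {e : Idem S} {u : S} {f : Idem S}
    (h : LQLabel p e u f) : toEModL e = a ∧ toEModL f = b ∧ Between e u f := by
  induction h with
  | nil e he => exact ⟨he, he, e, by rw [e.2, e.2]⟩
  | cons h r ih =>
    refine ⟨ih.1, r.cod, between_iff.2 ⟨?_, ?_⟩⟩
    · rw [← mul_assoc, (between_iff.1 ih.2.2).1]
    · rw [mul_assoc, (between_iff.1 r.between).2]

theorem LQLabel.exists {a b : EModL S} (p : Quiver.Path a b) :
    ∃ (e : Idem S) (u : S) (f : Idem S), LQLabel p e u f := by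
  induction p with
  | nil =>
    obtain ⟨e, he⟩ := Quotient.exists_rep a
    exact ⟨e, e, e, LQLabel.nil e he⟩
  | cons p r ih =>
    obtain ⟨e, u, f, h⟩ := ih
    exact ⟨e, _, _, LQLabel.cons h r⟩

/-! ### The functor `𝔏` -/

/-- The object map `e ↦ S e` from `E/ℒ` to the principal left ideals. -/
def objL (a : EModL S) : LS S :=
  Quotient.lift LS.of (fun _ _ h => by
    have : ∀ {x y : LS S}, x.carrier = y.carrier → x = y := by
      rintro ⟨x, _⟩ ⟨y, _⟩ rfl
      rfl
    exact this (leftIdeal_eq.2 h)) a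

variable (S) in
/-- The functor on the free category with `r(e, u, f) ↦ ρ(e, u, f)` on the morphisms of `ℒ_Q`. -/
def preL : Paths (EModL S) ⥤ LS S :=
  Paths.lift
    { obj := objL
      map := fun {_ _} r => LS.rho (LQEdge.e r) (LQEdge.u r) (LQEdge.f r)
        (congrArg objL (LQEdge.dom r)) (congrArg objL (LQEdge.cod r)) (LQEdge.between r) }

theorem preL_map_apply {a b : EModL S} {p : Quiver.Path a b} {e : Idem S} {u : S} {f : Idem S}
    (h : LQLabel p e u f) (x : (objL a).carrier) :
    (LS.Hom.toFun ((preL S).map (X := a) (Y := b) p) x : S) = x * u := by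
  induction h with
  | nil e he =>
    subst he
    exact (mem_leftIdeal.1 x.2).symm
  | cons h r ih =>
    rw [← mul_assoc, ← ih]
    rfl

variable (S) in
/-- The functor `𝔏 : ℒ_G ⥤ ℒ_S` with `𝔏(e) = S e` and `𝔏(r(e, u, f)) = ρ(e, u, f)`. -/
def functorL : LG S ⥤ LS S :=
  CategoryTheory.Quotient.lift (LQRel S) (preL S) (by
    rintro a b p q ⟨e, u, f, g, v, h, hp, hq, heg, hfh, huv⟩
    refine LS.hom_ext fun x => ?_
    refine (preL_map_apply hp x).trans (Eq.trans ?_ (preL_map_apply hq x).symm)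
    have hx : (x : S) * e = x := by
      obtain ⟨rfl, _⟩ := hp.spec
      exact mem_leftIdeal.1 x.2
    rw [huv, ← mul_assoc, hx])

variable (S) in
/-- The functor `ℜ : ℛ_G ⥤ ℛ_S` with `ℜ(e) = e S` and `ℜ(l(e, u, f)) = λ(e, u, f)`. -/
abbrev functorR : RG S ⥤ RS S := functorL Sᵐᵒᵖ

end

/-! ### Morphisms as triples

Both `ℒ_S` and `ℒ_G` have objects given by the idempotents `e` up to `ℒ`, and morphisms given by
triples `(e, u, f)` with `u ∈ e S f`. The principal cones and the functors `Γ` and `Δ` are built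
in the same way from such a description of the morphisms. -/

/-- A description of the objects and morphisms of `C` by the idempotents of `S` and by triples
`(e, u, f)` with `u ∈ e S f`. -/
class TripleModel (S : Type u) [Semigroup S] (C : Type u) [Category.{u} C] [Inclusions C] where
  of : Idem S → C
  mor : ∀ {c d : C} (e : Idem S) (u : S) (f : Idem S), of e = c → of f = d → Between e u f →
    (c ⟶ d)
  of_surjective : Function.Surjective of
  of_eq_iff : ∀ {e f : Idem S}, of e = of f ↔ GreenL e f
  mor_surjective : ∀ {c d : C} (e f : Idem S) (he : of e = c) (hf : of f = d) (m : c ⟶ d),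
    ∃ (u : S) (hu : Between e u f), m = mor e u f he hf hu
  mor_eq_iff : ∀ {c d : C} {e f g h : Idem S} {u v : S} (he : of e = c) (hf : of f = d)
    (hu : Between e u f) (hg : of g = c) (hh : of h = d) (hv : Between g v h),
    mor e u f he hf hu = mor g v h hg hh hv ↔ u = e * v
  mor_id : ∀ {c : C} (e : Idem S) (he : of e = c) (h : Between e (e : S) e),
    mor e e e he he h = 𝟙 c
  mor_comp : ∀ {c d d' : C} {e f g h : Idem S} {u v : S} (he : of e = c) (hf : of f = d)
    (hu : Between e u f) (hg : of g = d) (hh : of h = d') (hv : Between g v h)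
    (huv : Between e (u * v) h),
    mor e u f he hf hu ≫ mor g v h hg hh hv = mor e (u * v) h he hh huv
  incl_iff : ∀ {c d : C} (m : c ⟶ d), incl m ↔
    ∃ (e f : Idem S) (he : of e = c) (hf : of f = d) (h : Between e (e : S) f),
      m = mor e e f he hf h

theorem LS.ext_carrier {S : Type u} [Semigroup S] {A B : LS S} (h : A.carrier = B.carrier) :
    A = B := by
  obtain ⟨A, _⟩ := A
  obtain ⟨B, _⟩ := B
  obtain rfl : A = B := h
  rfl

theorem LS.mul_eq {S : Type u} [Semigroup S] {A : LS S} {e : Idem S} (he : LS.of e = A)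
    (x : A.carrier) : (x : S) * e = x := by
  subst he
  exact mem_leftIdeal.1 x.2

theorem LS.idem_mem {S : Type u} [Semigroup S] {A : LS S} {e : Idem S} (he : LS.of e = A) :
    (e : S) ∈ A.carrier := by
  subst he
  exact mem_leftIdeal.2 e.2

/-- In `ℒ_S` the triple `(e, u, f)` gives the morphism `ρ(e, u, f)`. -/
instance (S : Type u) [Semigroup S] : TripleModel S (LS S) where
  of := LS.of
  mor := LS.rho
  of_surjective A := by
    obtain ⟨e, he⟩ := A.exists_idem
    exact ⟨e, LS.ext_carrier he⟩
  of_eq_iff {e f} := by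
    rw [← leftIdeal_eq]
    exact ⟨fun h => congrArg LS.carrier h, fun h => LS.ext_carrier h⟩
  mor_surjective {A B} e f he hf m := by
    obtain ⟨g, v, h, hg, hh, hv, hm⟩ := LS.Hom.exists_eq m
    refine ⟨e * v, between_iff.2 ⟨by rw [← mul_assoc, e.2], ?_⟩, LS.hom_ext fun x => ?_⟩
    · rw [mul_assoc]
      have : v * f = v := by
        have h1 := (between_iff.1 hv).2
        have h2 := LS.mul_eq hf ⟨h, LS.idem_mem (LS.ext_carrier hh : LS.of h = B)⟩
        dsimp only at h2
        rw [← h1, mul_assoc, h2]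
      rw [this]
    · rw [hm]
      change _ = (x : S) * (e * v)
      rw [← mul_assoc, LS.mul_eq he]
  mor_eq_iff {A B e f g h u v} he hf hu hg hh hv := by
    constructor
    · intro H
      have : (e : S) * u = e * v :=
        congrArg (fun m : A ⟶ B => (LS.Hom.toFun m ⟨e, LS.idem_mem he⟩ : S)) H
      rw [← this, (between_iff.1 hu).1]
    · rintro rfl
      refine LS.hom_ext fun x => ?_
      change (x : S) * (e * v) = x * v
      rw [← mul_assoc, LS.mul_eq he]
  mor_id e he h := LS.hom_ext fun x => LS.mul_eq he x
  mor_comp he hf hu hg hh hv huv := LS.hom_ext fun x => mul_assoc _ _ _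
  incl_iff {A B} m := by
    constructor
    · intro H
      obtain ⟨e, he⟩ := A.exists_idem
      obtain ⟨f, hf⟩ := B.exists_idem
      have he' : LS.of e = A := LS.ext_carrier he
      have hf' : LS.of f = B := LS.ext_carrier hf
      have hef : (e : S) * f = e := by
        have h1 := H ⟨e, LS.idem_mem he'⟩
        have h2 := LS.mul_eq hf' (LS.Hom.toFun m ⟨e, LS.idem_mem he'⟩)
        rw [h1] at h2
        exact h2
      refine ⟨e, f, he', hf', between_iff.2 ⟨e.2, hef⟩, LS.hom_ext fun x => ?_⟩
      rw [H x]
      exact (LS.mul_eq he' x).symm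
    · rintro ⟨e, f, he, hf, h, rfl⟩ x
      exact LS.mul_eq he x

/-- Every `u ∈ e S f` gives a morphism `r(e, u, f) = r(e, g, g) r(g, u, h) r(h, h, f)` of the
free category on `ℒ_Q`. -/
theorem exists_path {S : Type u} [Semigroup S] [IsRegularSemigroup S] {a b : EModL S}
    (e : Idem S) (u : S) (f : Idem S) (he : toEModL e = a) (hf : toEModL f = b)
    (hu : Between e u f) : ∃ p : Quiver.Path a b, LQLabel p e u f := by
  obtain ⟨v, h₁, h₂⟩ := IsRegularSemigroup.exists_inverse u
  obtain ⟨heu, huf⟩ := between_iff.1 hu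
  have hg : u * v * e * (u * v * e) = u * v * e := by
    calc u * v * e * (u * v * e) = u * v * (e * u) * v * e := by simp only [mul_assoc]
      _ = u * v * e := by rw [heu, h₁]
  let g : Idem S := ⟨u * v * e, hg⟩
  have hh : v * u * (v * u) = v * u := by rw [← mul_assoc, h₂]
  let h : Idem S := ⟨v * u, hh⟩
  let r₁ : LQEdge a (toEModL g) := ⟨e, g, g, he, rfl, Or.inr (Or.inl ⟨g, rfl, ⟨g.2, g.2⟩,
    by change u * v * e * e = u * v * e; rw [mul_assoc, e.2],
    by change e * (u * v * e) = u * v * e; rw [← mul_assoc, ← mul_assoc, heu]⟩)⟩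
  let m : GHom g h := ⟨u, v * e,
    by rw [← mul_assoc, mul_assoc, heu, h₁],
    by rw [mul_assoc v, heu, ← mul_assoc, h₂],
    by change u * (v * e) = u * v * e; rw [mul_assoc],
    by change v * e * u = v * u; rw [mul_assoc, heu]⟩
  let r₂ : LQEdge (toEModL g) (toEModL h) := ⟨g, u, h, rfl, rfl, Or.inr (Or.inr ⟨m, rfl⟩)⟩
  let r₃ : LQEdge (toEModL h) b := ⟨h, h, f, rfl, hf, Or.inl
    ⟨by change v * u * f = v * u; rw [mul_assoc, huf], rfl⟩⟩
  refine ⟨((Quiver.Path.nil.cons r₁).cons r₂).cons r₃, ?_⟩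
  have H := ((LQLabel.nil e he).cons r₁).cons r₂ |>.cons r₃
  have hval : (e : S) * (u * v * e) * u * (v * u) = u := by
    calc (e : S) * (u * v * e) * u * (v * u) = (e * u) * v * (e * u) * v * u := by
          simp only [mul_assoc]
      _ = u := by rw [heu, h₁, h₁]
  exact hval ▸ H

theorem LG.as_eq {S : Type u} [Semigroup S] {a : LG S} {e : Idem S} (he : LG.of e = a) :
    toEModL e = a.as := by
  subst he
  rfl

/-- The morphism `r(e, u, f)` of `ℒ_G`, for `u ∈ e S f`. -/
noncomputable def LG.r {S : Type u} [Semigroup S] [IsRegularSemigroup S] {a b : LG S}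
    (e : Idem S) (u : S) (f : Idem S) (he : LG.of e = a) (hf : LG.of f = b)
    (hu : Between e u f) : a ⟶ b :=
  LG.ofPath (exists_path e u f (LG.as_eq he)
    (LG.as_eq hf) hu).choose

theorem LG.r_spec {S : Type u} [Semigroup S] [IsRegularSemigroup S] {a b : LG S}
    (e : Idem S) (u : S) (f : Idem S) (he : LG.of e = a) (hf : LG.of f = b)
    (hu : Between e u f) : ∃ p : Quiver.Path (V := EModL S) a.as b.as,
      LQLabel p e u f ∧ LG.r e u f he hf hu = LG.ofPath p :=
  ⟨_, (exists_path e u f (LG.as_eq he)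
    (LG.as_eq hf) hu).choose_spec, rfl⟩

/-- Two paths have the same class in `ℒ_G` exactly when they are related by `∼`. -/
theorem LG.ofPath_eq_iff {S : Type u} [Semigroup S] {a b : LG S}
    {p q : Quiver.Path (V := EModL S) a.as b.as} {e f g h : Idem S} {u v : S}
    (hp : LQLabel p e u f) (hq : LQLabel q g v h) :
    LG.ofPath p = LG.ofPath q ↔ u = e * v := by
  have hpe := hp.spec
  have hqe := hq.spec
  constructor
  · intro H
    have H' := congrArg (fun m : a ⟶ b => (functorL S).map m) H
    have hmem : (e : S) ∈ (objL a.as).carrier := by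
      rw [← hpe.1]
      exact mem_leftIdeal.2 e.2
    have h1 := preL_map_apply hp ⟨e, hmem⟩
    have h2 := preL_map_apply hq ⟨e, hmem⟩
    have h3 : (preL S).map (X := a.as) (Y := b.as) p = (preL S).map (X := a.as) (Y := b.as) q := H'
    rw [h3] at h1
    have h4 : (e : S) * u = e * v := h1.symm.trans h2
    rw [← h4, (between_iff.1 hpe.2.2).1]
  · intro H
    exact CategoryTheory.Quotient.sound (LQRel S) ⟨e, u, f, g, v, h, hp, hq,
      toEModL_eq.1 (hpe.1.trans hqe.1.symm), toEModL_eq.1 (hpe.2.1.trans hqe.2.1.symm), H⟩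

theorem LQLabel.comp {S : Type u} [Semigroup S] {a b c : EModL S} {p : Quiver.Path a b}
    {q : Quiver.Path b c} {e f g h : Idem S} {u v : S} (hp : LQLabel p e u f)
    (hq : LQLabel q g v h) : ∃ h' : Idem S, LQLabel (p.comp q) e (u * v) h' := by
  induction hq with
  | nil g hg =>
    refine ⟨f, ?_⟩
    have hfg : GreenL f g := toEModL_eq.1 (hp.spec.2.1.trans hg.symm)
    have : u * g = u := by
      rw [← (between_iff.1 hp.spec.2.2).2, mul_assoc]
      exact congrArg (u * ·) hfg.1
    rw [this]
    exact hp
  | cons hq r ih =>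
    obtain ⟨h', H⟩ := ih
    refine ⟨r.f, ?_⟩
    rw [← mul_assoc]
    exact H.cons r

/-- In `ℒ_G` the triple `(e, u, f)` gives the morphism `r(e, u, f)`. -/
noncomputable instance (S : Type u) [Semigroup S] [IsRegularSemigroup S] :
    TripleModel S (LG S) where
  of := LG.of
  mor := LG.r
  of_surjective := by
    rintro ⟨a⟩
    obtain ⟨e, he⟩ := Quotient.exists_rep a
    exact ⟨e, congrArg CategoryTheory.Quotient.mk he⟩
  of_eq_iff {e f} := by
    rw [← toEModL_eq]
    exact ⟨fun h => congrArg (fun a : LG S => (a.as : EModL S)) h,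
      fun h => congrArg CategoryTheory.Quotient.mk h⟩
  mor_surjective {a b} e f he hf m := by
    obtain ⟨p, rfl⟩ : ∃ p : Quiver.Path (V := EModL S) a.as b.as, m = LG.ofPath p := by
      obtain ⟨p, hp⟩ := (CategoryTheory.Quotient.functor (LQRel S)).map_surjective
        (X := a.as) (Y := b.as) m
      exact ⟨p, hp.symm⟩
    obtain ⟨g, v, h, hp⟩ := LQLabel.exists p
    have hs := hp.spec
    have hb : Between e (e * v) f := by
      refine between_iff.2 ⟨by rw [← mul_assoc, e.2], ?_⟩
      have hfh : GreenL h f := toEModL_eq.1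
        (hs.2.1.trans (LG.as_eq hf).symm)
      rw [mul_assoc, ← (between_iff.1 hs.2.2).2, mul_assoc]
      exact congrArg (fun x => e * (v * x)) hfh.1
    refine ⟨e * v, hb, ?_⟩
    obtain ⟨q, hq, hq'⟩ := LG.r_spec e (e * v) f he hf hb
    rw [hq']
    exact ((LG.ofPath_eq_iff hq hp).2 rfl).symm
  mor_eq_iff he hf hu hg hh hv := by
    obtain ⟨p, hp, hp'⟩ := LG.r_spec _ _ _ he hf hu
    obtain ⟨q, hq, hq'⟩ := LG.r_spec _ _ _ hg hh hv
    rw [hp', hq']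
    exact LG.ofPath_eq_iff hp hq
  mor_id {a} e he h := by
    obtain ⟨p, hp, hp'⟩ := LG.r_spec _ _ _ he he h
    rw [hp']
    have hn : LQLabel (Quiver.Path.nil : Quiver.Path (V := EModL S) a.as a.as) e e e :=
      LQLabel.nil e (LG.as_eq he)
    exact (LG.ofPath_eq_iff hp hn).2 e.2.symm
  mor_comp he hf hu hg hh hv huv := by
    obtain ⟨p, hp, hp'⟩ := LG.r_spec _ _ _ he hf hu
    obtain ⟨q, hq, hq'⟩ := LG.r_spec _ _ _ hg hh hv
    obtain ⟨w, hw, hw'⟩ := LG.r_spec _ _ _ he hh huv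
    rw [hp', hq', hw']
    obtain ⟨h', hpq⟩ := hp.comp hq
    exact (LG.ofPath_eq_iff hpq hw).2 (between_iff.1 huv).1.symm
  incl_iff {a b} m := by
    constructor
    · rintro ⟨⟨e, u, f, he, hf, hmem⟩, ⟨hef, hu⟩, rfl⟩
      obtain rfl : u = e := hu
      have hb : Between e (e : S) f := between_iff.2 ⟨e.2, hef⟩
      refine ⟨e, f, congrArg CategoryTheory.Quotient.mk he, congrArg CategoryTheory.Quotient.mk hf,
        hb, ?_⟩
      obtain ⟨p, hp, hp'⟩ := LG.r_spec (a := a) (b := b) e e f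
        (congrArg CategoryTheory.Quotient.mk he) (congrArg CategoryTheory.Quotient.mk hf) hb
      rw [hp']
      refine (LG.ofPath_eq_iff ((LQLabel.nil e he).cons _) hp).2 rfl
    · rintro ⟨e, f, he, hf, h, rfl⟩
      obtain ⟨p, hp, hp'⟩ := LG.r_spec _ _ _ he hf h
      have hef : InPL e (e : S) f := ⟨(between_iff.1 h).2, rfl⟩
      have he' := LG.as_eq he
      refine ⟨⟨e, e, f, he', LG.as_eq hf, Or.inl hef⟩, hef, ?_⟩
      rw [hp']
      refine (LG.ofPath_eq_iff hp ((LQLabel.nil e he').cons _)).2 ?_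
      change (e : S) = e * (e * e)
      rw [e.2, e.2]

/-- `𝔏(r(e, u, f)) = ρ(e, u, f)`. -/
theorem functorL_map_r {S : Type u} [Semigroup S] [IsRegularSemigroup S] (e : Idem S) (u : S)
    (f : Idem S) (h : Between e u f) :
    (functorL S).map (LG.r e u f rfl rfl h) = LS.rho e u f rfl rfl h := by
  obtain ⟨p, hp, hp'⟩ := LG.r_spec e u f rfl rfl h
  rw [hp']
  exact LS.hom_ext fun x => preL_map_apply hp x

/-! ### Principal cones and normality -/

namespace TripleModel

variable {S : Type u} [Semigroup S] {C : Type u} [Category.{u} C] [Inclusions C] [TripleModel S C]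

variable (S) in
/-- A representative in `E(S)` of an object. -/
noncomputable def rep (c : C) : Idem S := (of_surjective (S := S) c).choose

theorem of_rep (c : C) : of (rep S c) = c := (of_surjective (S := S) c).choose_spec

theorem green {c : C} {e f : Idem S} (he : of e = c) (hf : of f = c) : (e : S) * f = e :=
  (of_eq_iff.1 (he.trans hf.symm)).1

theorem between_self (e : Idem S) : Between e (e : S) e := between_iff.2 ⟨e.2, e.2⟩

theorem between_mul (g : Idem S) (e : Idem S) : Between g ((g : S) * e) e :=
  between_iff.2 ⟨by rw [← mul_assoc, g.2], by rw [mul_assoc, e.2]⟩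

theorem between_comp {e f g h : Idem S} {u v : S} (hu : Between e u f) (hv : Between g v h) :
    Between e (u * v) h :=
  between_iff.2 ⟨by rw [← mul_assoc, (between_iff.1 hu).1],
    by rw [mul_assoc, (between_iff.1 hv).2]⟩

/-- The principal cone `r^e` with apex `e` and components `r^e(g) = r(g, g e, e)`. -/
noncomputable def principalCone (e : Idem S) {c : C} (he : of e = c) : NormalCone c where
  comp a := mor (rep S a) (rep S a * e) e (of_rep a) he (between_mul _ _)
  incl_comp {a b} j hj := by
    obtain ⟨g, h, hg, hh, hb, rfl⟩ := (incl_iff (S := S) j).1 hj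
    rw [mor_comp _ _ _ _ _ _ (between_comp hb (between_mul _ _)), mor_eq_iff,
      ← mul_assoc, ← mul_assoc, green hg (of_rep a)]
    have : (g : S) * rep S b = g := by
      rw [← (between_iff.1 hb).2, mul_assoc, green hh (of_rep b)]
    rw [this]
  exists_iso := by
    refine ⟨c, ?_⟩
    have : mor (rep S c) (rep S c * e : S) e (of_rep c) he (between_mul _ _) = 𝟙 c := by
      rw [← mor_id e he (between_self e)]
      exact (mor_eq_iff _ _ _ _ _ _).2 rfl
    rw [this]
    infer_instance

theorem principalCone_comp (e : Idem S) {c : C} (he : of e = c) {a : C} (g : Idem S)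
    (hg : of g = a) : (principalCone e he).comp a = mor g (g * e) e hg he (between_mul _ _) := by
  refine (mor_eq_iff _ _ _ _ _ _).2 ?_
  rw [← mul_assoc, green (of_rep a) hg]

theorem categoryWithSubobjects (S : Type u) [Semigroup S] (C : Type u) [Category.{u} C]
    [Inclusions C] [TripleModel S C] : CategoryWithSubobjects C where
  incl_id a := by
    refine (incl_iff (S := S) _).2 ⟨rep S a, rep S a, of_rep a, of_rep a, between_self _, ?_⟩
    exact (mor_id _ _ _).symm
  incl_comp f g Hf Hg := by
    obtain ⟨e, f, he, hf, h, rfl⟩ := (incl_iff (S := S) _).1 Hf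
    obtain ⟨e', f', he', hf', h', rfl⟩ := (incl_iff (S := S) _).1 Hg
    have H := between_comp h h'
    have : (e : S) * e' = e := by rw [← (between_iff.1 h).2, mul_assoc, green hf he']
    refine (incl_iff (S := S) _).2 ⟨e, f', he, hf', by rwa [this] at H, ?_⟩
    rw [mor_comp _ _ _ _ _ _ H, mor_eq_iff, e.2, this]
  incl_unique f g Hf Hg := by
    obtain ⟨e, f, he, hf, h, rfl⟩ := (incl_iff (S := S) _).1 Hf
    obtain ⟨e', f', he', hf', h', rfl⟩ := (incl_iff (S := S) _).1 Hg
    exact (mor_eq_iff _ _ _ _ _ _).2 (green he he').symm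
  incl_antisymm {a b} f g Hf Hg := by
    obtain ⟨e, f, he, hf, h, rfl⟩ := (incl_iff (S := S) _).1 Hf
    obtain ⟨f', e', hf', he', h', rfl⟩ := (incl_iff (S := S) _).1 Hg
    rw [← he, ← hf]
    refine of_eq_iff.2 ⟨(between_iff.1 h).2, ?_⟩
    change (f : S) * e = f
    have h1 : (f : S) * e' = f := by
      rw [← green hf hf', mul_assoc, (between_iff.1 h').2]
    rw [← h1, mul_assoc, green he' he]
  incl_mono {a b} f Hf := by
    obtain ⟨e, f, he, hf, h, rfl⟩ := (incl_iff (S := S) _).1 Hf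
    refine ⟨fun {z} x y hxy => ?_⟩
    obtain ⟨u, hu, rfl⟩ := mor_surjective (rep S z) e (of_rep z) he x
    obtain ⟨v, hv, rfl⟩ := mor_surjective (rep S z) e (of_rep z) he y
    rw [mor_comp _ _ _ _ _ _ (between_comp hu h),
      mor_comp _ _ _ _ _ _ (between_comp hv h), mor_eq_iff] at hxy
    rw [mor_eq_iff, ← (between_iff.1 hu).2, hxy, (between_iff.1 hv).2]
  incl_of_comp {a b c} k g Hg hkg := by
    obtain ⟨f, f', hf, hf', h, rfl⟩ := (incl_iff (S := S) _).1 Hg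
    obtain ⟨e, e', he, he', h', heq⟩ := (incl_iff (S := S) _).1 hkg
    obtain ⟨u, hu, rfl⟩ := mor_surjective e f he hf k
    rw [mor_comp _ _ _ _ _ _ (between_comp hu h), mor_eq_iff, e.2,
      (between_iff.1 hu).2] at heq
    subst heq
    exact (incl_iff (S := S) _).2 ⟨e, f, he, hf, hu, rfl⟩

theorem normalCategory (S : Type u) [Semigroup S] [IsRegularSemigroup S] (C : Type u) [Category.{u} C]
    [Inclusions C] [TripleModel S C] : NormalCategory C where
  toCategoryWithSubobjects := categoryWithSubobjects S C
  normal_factorization {c d} m := by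
    obtain ⟨u, hu, rfl⟩ := mor_surjective (rep S c) (rep S d) (of_rep c) (of_rep d) m
    generalize_proofs hc hd at *
    generalize rep S c = e at *
    generalize rep S d = f at *
    obtain ⟨v, h₁, h₂⟩ := IsRegularSemigroup.exists_inverse u
    obtain ⟨heu, huf⟩ := between_iff.1 hu
    have hg : u * v * e * (u * v * e) = u * v * e := by
      calc u * v * e * (u * v * e) = u * v * (e * u) * v * e := by simp only [mul_assoc]
        _ = u * v * e := by rw [heu, h₁]
    let g : Idem S := ⟨u * v * e, hg⟩
    have hh : v * u * (v * u) = v * u := by rw [← mul_assoc, h₂]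
    let h : Idem S := ⟨v * u, hh⟩
    have heg : (e : S) * g = g := by
      change (e : S) * (u * v * e) = u * v * e
      rw [← mul_assoc, ← mul_assoc, heu]
    have hge : (g : S) * e = g := by
      change u * v * e * e = u * v * e
      rw [mul_assoc, e.2]
    have hgu : (g : S) * u = u := by
      change u * v * e * u = u
      rw [mul_assoc, heu, h₁]
    have huh : u * (h : S) = u := by
      change u * (v * u) = u
      rw [← mul_assoc, h₁]
    have hhf : (h : S) * f = h := by
      change v * u * f = v * u
      rw [mul_assoc, huf]
    have bq : Between e (g : S) g := between_iff.2 ⟨heg, g.2⟩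
    have bi : Between g (g : S) e := between_iff.2 ⟨g.2, hge⟩
    have bu : Between g u h := between_iff.2 ⟨hgu, huh⟩
    have bj : Between h (h : S) f := between_iff.2 ⟨h.2, hhf⟩
    have bv : Between h (v * e) g := by
      refine between_iff.2 ⟨?_, ?_⟩
      · change v * u * (v * e) = v * e
        rw [← mul_assoc, h₂]
      · change v * e * (u * v * e) = v * e
        calc v * e * (u * v * e) = v * (e * u) * v * e := by simp only [mul_assoc]
          _ = v * e := by rw [heu, h₂]
    refine ⟨{
      q := mor e (g : S) g hc rfl bq
      u := mor g u h rfl rfl bu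
      j := mor h (h : S) f rfl hd bj
      retraction := ⟨mor g (g : S) e rfl hc bi,
        (incl_iff (S := S) _).2 ⟨g, e, rfl, hc, bi, rfl⟩, ?_⟩
      iso := ⟨mor h (v * e) g rfl rfl bv, ?_, ?_⟩
      inclusion := (incl_iff (S := S) _).2 ⟨h, f, rfl, hd, bj, rfl⟩
      fac := ?_ }⟩
    · rw [mor_comp _ _ _ _ _ _ (between_comp bi bq), ← mor_id g rfl (between_self g),
        mor_eq_iff]
    · rw [mor_comp _ _ _ _ _ _ (between_comp bu bv), ← mor_id g rfl (between_self g),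
        mor_eq_iff, g.2]
      exact (mul_assoc u v e).symm
    · rw [mor_comp _ _ _ _ _ _ (between_comp bv bu), ← mor_id h rfl (between_self h),
        mor_eq_iff, h.2]
      change v * e * u = v * u
      rw [mul_assoc, heu]
    · rw [mor_comp _ _ _ _ _ _ (between_comp bu bj),
        mor_comp _ _ _ _ _ _ (between_comp bq (between_comp bu bj)), mor_eq_iff,
        huh, hgu, heu]
  incl_splits {c d} j hj := by
    obtain ⟨e, f, he, hf, h, rfl⟩ := (incl_iff (S := S) _).1 hj
    refine ⟨mor f (f * e) e hf he (between_mul _ _), ?_⟩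
    rw [mor_comp _ _ _ _ _ _ (between_comp h (between_mul _ _)),
      ← mor_id e he (between_self e), mor_eq_iff, ← mul_assoc, (between_iff.1 h).2]
  exists_cone c := by
    refine ⟨principalCone (rep S c) (of_rep c), ?_⟩
    rw [principalCone_comp _ _ (rep S c) (of_rep c), ← mor_id (rep S c) (of_rep c) (between_self _)]
    exact (mor_eq_iff _ _ _ _ _ _).2 rfl

end TripleModel

/-- `ℒ_S` (and, applied to the opposite semigroup, `ℛ_S`) is a normal category. -/
instance (S : Type u) [Semigroup S] [IsRegularSemigroup S] : NormalCategory (LS S) :=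
  TripleModel.normalCategory S (LS S)

/-- `ℒ_G` (and, applied to the opposite semigroup, `ℛ_G`) is a normal category. -/
instance (S : Type u) [Semigroup S] [IsRegularSemigroup S] : NormalCategory (LG S) :=
  TripleModel.normalCategory S (LG S)

/-! ### The cross-connections of `S` and of the inductive groupoid -/

namespace TripleModel

section

variable {S T : Type u} [Semigroup S] [Semigroup T] (φ : T ≃* Sᵐᵒᵖ)

/-- The idempotent of `S` corresponding to an idempotent of an anti-isomorphic semigroup `T`. -/
def antiIdem (e : Idem T) : Idem S :=
  ⟨(φ e).unop, by rw [← MulOpposite.unop_mul, ← map_mul, e.2]⟩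

theorem between_anti {e f : Idem T} {u : T} (h : Between e u f) :
    Between (antiIdem φ f) (φ u).unop (antiIdem φ e) := by
  obtain ⟨h₁, h₂⟩ := between_iff.1 h
  refine between_iff.2 ⟨?_, ?_⟩
  · change (φ f).unop * (φ u).unop = (φ u).unop
    rw [← MulOpposite.unop_mul, ← map_mul, h₂]
  · change (φ u).unop * (φ e).unop = (φ u).unop
    rw [← MulOpposite.unop_mul, ← map_mul, h₁]

variable (C : Type u) [Category.{u} C] [Inclusions C] [NormalCategory C] [TripleModel S C]

/-- The H-functor `H(r^e; -)` of the principal cone `r^e`. -/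
noncomputable abbrev gammaObj (e : Idem T) : NormalDual C :=
  NormalDual.of (principalCone (C := C) (antiIdem φ e) rfl)

/-- The natural transformation `η_{r^e} C(r(f, u, e), -) η_{r^f}⁻¹` from `H(r^e; -)` to
`H(r^f; -)`. -/
noncomputable def gammaMap (e : Idem T) (u : T) (f : Idem T) (h : Between e u f) :
    gammaObj φ C e ⟶ gammaObj φ C f :=
  ⟨(eta (principalCone (C := C) (antiIdem φ e) rfl)).hom ≫
    coyoneda.map (mor (antiIdem φ f) (φ u).unop (antiIdem φ e) rfl rfl (between_anti φ h)).op ≫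
    (eta (principalCone (C := C) (antiIdem φ f) rfl)).inv⟩

theorem gammaMap_id (e : Idem T) (h : Between e (e : T) e) :
    gammaMap φ C e e e h = 𝟙 _ := by
  refine NormalDual.Hom.ext ?_
  have : mor (antiIdem φ e) (φ e).unop (antiIdem φ e) rfl rfl (between_anti φ h) =
      𝟙 (of (antiIdem φ e) : C) := mor_id _ _ _
  simp only [gammaMap]
  rw [this, op_id, CategoryTheory.Functor.map_id, Category.id_comp, Iso.hom_inv_id]
  rfl

theorem gammaMap_comp {e f h : Idem T} {u v : T}
    (hu : Between e u f) (hv : Between f v h) (huv : Between e (u * v) h) :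
    gammaMap φ C e u f hu ≫ gammaMap φ C f v h hv = gammaMap φ C e (u * v) h huv := by
  refine NormalDual.Hom.ext ?_
  have := mor_comp (C := C) rfl rfl (between_anti φ hv) rfl rfl (between_anti φ hu)
    (by simpa using between_anti φ huv)
  change (gammaMap φ C e u f hu).nat ≫ (gammaMap φ C f v h hv).nat = _
  simp only [gammaMap, Category.assoc, Iso.inv_hom_id_assoc, ← Functor.map_comp_assoc, ← op_comp]
  rw [this]
  simp only [map_mul, MulOpposite.unop_mul]

theorem gammaMap_congr {D : Type u} [Category.{u} D] [Inclusions D] [TripleModel T D] {d d' : D}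
    {e f : Idem T} {u v : T} (he : of e = d) (hf : of f = d') (hu : Between e u f)
    (hv : Between e v f) (h : mor e u f he hf hu = mor e v f he hf hv) :
    gammaMap φ C e u f hu = gammaMap φ C e v f hv := by
  rw [mor_eq_iff, (between_iff.1 hv).1] at h
  subst h
  rfl

/-- The functor `D ⥤ N*C` given on objects by `e ↦ H(r^e; -)` and on morphisms by
`(e, u, f) ↦ η_{r^e} C(r(f, u, e), -) η_{r^f}⁻¹`. It does not depend on the representatives
used here, see `gamma_obj` and `gamma_map`. -/
noncomputable def gamma (D : Type u) [Category.{u} D] [Inclusions D] [TripleModel T D] :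
    D ⥤ NormalDual C where
  obj d := gammaObj φ C (rep T d)
  map {d d'} l :=
    gammaMap φ C (rep T d) _ (rep T d')
      (mor_surjective (rep T d) (rep T d') (of_rep d) (of_rep d') l).choose_spec.choose
  map_id d := by
    rw [← gammaMap_id φ C (rep T d) (between_self _)]
    refine gammaMap_congr φ C (of_rep d) (of_rep d) _ _ ?_
    rw [mor_id]
    exact (mor_surjective (rep T d) (rep T d) (of_rep d) (of_rep d)
      (𝟙 d)).choose_spec.choose_spec.symm
  map_comp {a b c} l m := by
    rw [gammaMap_comp φ C _ _ (between_comp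
      (mor_surjective (rep T a) (rep T b) (of_rep a) (of_rep b) l).choose_spec.choose
      (mor_surjective (rep T b) (rep T c) (of_rep b) (of_rep c) m).choose_spec.choose)]
    refine gammaMap_congr φ C (of_rep a) (of_rep c) _ _ ?_
    rw [← mor_comp (of_rep a) (of_rep b)
      (mor_surjective (rep T a) (rep T b) (of_rep a) (of_rep b) l).choose_spec.choose
      (of_rep b) (of_rep c)
      (mor_surjective (rep T b) (rep T c) (of_rep b) (of_rep c) m).choose_spec.choose,
      ← (mor_surjective (rep T a) (rep T b) (of_rep a) (of_rep b) l).choose_spec.choose_spec,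
      ← (mor_surjective (rep T b) (rep T c) (of_rep b) (of_rep c) m).choose_spec.choose_spec]
    exact (mor_surjective (rep T a) (rep T c) (of_rep a) (of_rep c)
      (l ≫ m)).choose_spec.choose_spec.symm

theorem gammaObj_eq {e f : Idem T} (h : GreenL e f) : gammaObj φ C e = gammaObj φ C f := by
  obtain ⟨h₁, h₂⟩ := h
  have h₁' : (antiIdem φ f : S) * antiIdem φ e = antiIdem φ e := by
    change (φ f).unop * (φ e).unop = (φ e).unop
    rw [← MulOpposite.unop_mul, ← map_mul]
    exact congrArg (fun x => (φ x).unop) h₁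
  have h₂' : (antiIdem φ e : S) * antiIdem φ f = antiIdem φ f := by
    change (φ e).unop * (φ f).unop = (φ f).unop
    rw [← MulOpposite.unop_mul, ← map_mul]
    exact congrArg (fun x => (φ x).unop) h₂
  refine NormalDual.ext (H_eq_of _ _ (mor _ _ _ rfl rfl (between_mul _ _))
    (mor _ _ _ rfl rfl (between_mul _ _)) (fun x => ?_) (fun x => ?_))
  · rw [principalCone_comp _ _ _ (of_rep x), principalCone_comp _ _ _ (of_rep x),
      mor_comp _ _ _ _ _ _ (between_comp (between_mul _ _) (between_mul _ _)), mor_eq_iff, h₂',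
      mul_assoc, h₂', ← mul_assoc, (rep S x).2]
  · rw [principalCone_comp _ _ _ (of_rep x), principalCone_comp _ _ _ (of_rep x),
      mor_comp _ _ _ _ _ _ (between_comp (between_mul _ _) (between_mul _ _)), mor_eq_iff, h₁',
      mul_assoc, h₁', ← mul_assoc, (rep S x).2]

theorem gamma_obj {D : Type u} [Category.{u} D] [Inclusions D] [TripleModel T D] (e : Idem T) :
    (gamma φ C D).obj (of e) = gammaObj φ C e :=
  gammaObj_eq φ C (of_eq_iff.1 (of_rep (of e : D)))

theorem NormalDual.eq_eqToHom {F G : NormalDual C} (h : F = G) (m : F ⟶ G) (hm : incl m) :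
    m = eqToHom h := by
  subst h
  refine NormalDual.Hom.ext ?_
  ext c x
  exact Subtype.ext (hm c x)

/-- `η_{r^e} C(r(f, u, e), -) η_{r^f}⁻¹` maps `r^e * k°` to `r^f * (r(f, u, e) k)°`. -/
theorem gammaMap_apply (e : Idem T) (u : T) (f : Idem T) (h : Between e u f) {c : C}
    (k : of (antiIdem φ e) ⟶ c)
    (hx : (⟨_, star (principalCone (antiIdem φ e) rfl) k⟩ : TC C) ∈ (gammaObj φ C e).fn.obj c) :
    (NormalDual.apply (gammaMap φ C e u f h) c ⟨_, hx⟩ : TC C) =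
      ⟨_, star (principalCone (antiIdem φ f) rfl)
        (mor (antiIdem φ f) (φ u).unop (antiIdem φ e) rfl rfl (between_anti φ h) ≫ k)⟩ := by
  have hk : (⟨_, hx⟩ : Hset (principalCone (C := C) (antiIdem φ e) rfl) c) = Hequiv _ c k := rfl
  change ((Hequiv _ c (mor (antiIdem φ f) (φ u).unop (antiIdem φ e) rfl rfl (between_anti φ h) ≫
    (Hequiv _ c).symm ⟨_, hx⟩) : Hset (principalCone (C := C) (antiIdem φ f) rfl) c) : TC C) = _
  rw [hk, Equiv.symm_apply_apply]
  rfl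

theorem gammaMap_eq_eqToHom {e f : Idem T} (h : GreenL e f) (hb : Between e (e : T) f) :
    gammaMap φ C e e f hb = eqToHom (gammaObj_eq φ C h) := by
  refine NormalDual.eq_eqToHom C _ _ ?_
  rintro c ⟨_, k, rfl⟩
  refine (gammaMap_apply φ C e e f hb k _).trans ?_
  refine cone_ext _ _ (imIncl _) (imIncl _) (imIncl_incl _) (imIncl_incl _) fun a => ?_
  have h₁ : (antiIdem φ f : S) * (φ e).unop = (φ e).unop := by
    change (φ f).unop * (φ e).unop = (φ e).unop
    rw [← MulOpposite.unop_mul, ← map_mul]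
    exact congrArg (fun x => (φ x).unop) h.1
  rw [star_comp_imIncl, star_comp_imIncl, ← Category.assoc]
  congr 1
  rw [principalCone_comp _ _ _ (of_rep a), principalCone_comp _ _ _ (of_rep a),
    mor_comp _ _ _ _ _ _ (between_comp (between_mul _ _) (between_anti φ hb)), mor_eq_iff,
    mul_assoc, h₁, ← mul_assoc, (rep S a).2]
  rfl

theorem gamma_map {D : Type u} [Category.{u} D] [Inclusions D] [TripleModel T D]
    (e : Idem T) (u : T) (f : Idem T) (h : Between e u f) :
    (gamma φ C D).map (mor e u f rfl rfl h) =
      eqToHom (gamma_obj φ C e) ≫ gammaMap φ C e u f h ≫ eqToHom (gamma_obj φ C f).symm := by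
  have he : GreenL (rep T (of e : D)) e := of_eq_iff.1 (of_rep (of e : D))
  have hf : GreenL f (rep T (of f : D)) := of_eq_iff.1 (of_rep (of f : D)).symm
  have be : Between (rep T (of e : D)) (rep T (of e : D) : T) e :=
    between_iff.2 ⟨(rep T (of e : D)).2, he.1⟩
  have bf : Between f (f : T) (rep T (of f : D)) := between_iff.2 ⟨f.2, hf.1⟩
  change gammaMap φ C (rep T (of e : D)) _ (rep T (of f : D))
      (mor_surjective (rep T (of e : D)) (rep T (of f : D)) (of_rep _) (of_rep _)
        (mor e u f rfl rfl h)).choose_spec.choose =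
    eqToHom (gammaObj_eq φ C he) ≫ gammaMap φ C e u f h ≫ eqToHom (gammaObj_eq φ C hf)
  rw [← gammaMap_eq_eqToHom φ C he be, ← gammaMap_eq_eqToHom φ C hf bf,
    gammaMap_comp φ C h bf (between_comp h bf),
    gammaMap_comp φ C be (between_comp h bf) (between_comp be (between_comp h bf))]
  refine gammaMap_congr φ C (of_rep _) (of_rep _) _ _ ?_
  have key := (mor_surjective (rep T (of e : D)) (rep T (of f : D)) (of_rep _) (of_rep _)
      (mor e u f rfl rfl h)).choose_spec.choose_spec
  refine key.symm.trans ((mor_eq_iff _ _ _ _ _ _).2 ?_)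
  rw [(between_iff.1 h).2, ← mul_assoc]
  have := (between_iff.1 h).1
  have h' := he.2
  unfold OmegaL at h'
  rw [h', this]

end

end TripleModel

section

variable (S : Type u) [Semigroup S] [IsRegularSemigroup S]

/-- The functor `Γ_S : ℛ_S ⥤ N*ℒ_S`, `Γ_S(e S) = H(ρ^e; -)`,
`Γ_S(λ(e, u, f)) = η_{ρ^e} ℒ_S(ρ(f, u, e), -) η_{ρ^f}⁻¹`. -/
noncomputable def GammaS : RS S ⥤ NormalDual (LS S) :=
  TripleModel.gamma (MulEquiv.refl Sᵐᵒᵖ) (LS S) (RS S)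

/-- The functor `Δ_S : ℒ_S ⥤ N*ℛ_S`, `Δ_S(S e) = H(λ^e; -)`,
`Δ_S(ρ(e, u, f)) = η_{λ^e} ℛ_S(λ(f, u, e), -) η_{λ^f}⁻¹`. -/
noncomputable def DeltaS : LS S ⥤ NormalDual (RS S) :=
  TripleModel.gamma (MulEquiv.opOp S) (RS S) (LS S)

/-- The functor `Γ_G : ℛ_G ⥤ N*ℒ_G`, `Γ_G(e) = H(r^e; -)`,
`Γ_G(l(e, u, f)) = η_{r^e} ℒ_G(r(f, u, e), -) η_{r^f}⁻¹`. -/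
noncomputable def GammaG : RG S ⥤ NormalDual (LG S) :=
  TripleModel.gamma (MulEquiv.refl Sᵐᵒᵖ) (LG S) (RG S)

/-- The functor `Δ_G : ℒ_G ⥤ N*ℛ_G`, `Δ_G(e) = H(l^e; -)`,
`Δ_G(r(e, u, f)) = η_{l^e} ℛ_G(l(f, u, e), -) η_{l^f}⁻¹`. -/
noncomputable def DeltaG : LG S ⥤ NormalDual (RG S) :=
  TripleModel.gamma (MulEquiv.opOp S) (RG S) (LG S)

end

end CrossConn

namespace CrossConn

open Inclusions (incl)

/-! ### Comparison of cones through their H-functors -/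

section

variable {C : Type u} [Category.{u} C] [Inclusions C] [NormalCategory C]

/-! The category of left ideals consists of translations and the category built from the groupoid
consists of paths modulo a relation, yet a morphism of either is a triple (e, u, f) with u ∈ e S f,
and the triples obey the same rules in both. With common end objects, (e, u, f) and (g, v, h) agree
exactly when u = e v; composition multiplies the middle terms; the inclusions are the triples (e, e,
f). `TripleModel` records these rules, and the functors `gamma` are built from them alone. It
therefore suffices to express all the data of a cross-connection through idempotents and triples:
two models of the same semigroup then carry the same data, and a functor preserving triples
transports it.

The translation rests on comparing cones by their H-functors. Two cones have equal H-functors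
exactly when each factors through the other (`exists_factor_of_H_eq`, with converse `H_eq_of`).
Hence an M-set can be read off from one cone, and a cone that is the identity at its apex is
determined by its H-functor. So E_Γ consists of the pairs given by a single idempotent
(`eGamma_gamma_iff`), and the idempotent cone attached to such a pair is principal
(`gammaCone_gamma`). By Yoneda, a commuting square becomes an equation between semigroup elements
(`commSquare_gamma_iff`): the transpose of r(e, u, f) is l(f, u, e), with the same u. Γ and Δ are
both instances of `gamma`, for mutually inverse anti-isomorphisms, so duality is the symmetry of
this equation.

The delicate axiom of a cross-connection is bijectivity on ideals. A cone factoring through r^h has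
the H-functor of a principal cone r^e with e ω^r h (`exists_idem_H_eq`), and below a common h the
functor H(r^e; -) determines the ℛ-class of e (`mul_eq_of_principalCone_factor`). -/

theorem comp_eq_of_cone_eq {c c' d : C} {σ : NormalCone c} {σ' : NormalCone c'}
    (h : (⟨c, σ⟩ : TC C) = ⟨c', σ'⟩) (j : c ⟶ d) (j' : c' ⟶ d) (hj : incl j) (hj' : incl j')
    (a : C) : σ.comp a ≫ j = σ'.comp a ≫ j' := by
  cases h
  rw [CategoryWithSubobjects.incl_unique j j' hj hj']

theorem mem_Hset_self {a : C} (γ : NormalCone a) : (⟨a, γ⟩ : TC C) ∈ Hset γ a :=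
  ⟨𝟙 a, cone_ext _ _ (imIncl _) (𝟙 a) (imIncl_incl _) (CategoryWithSubobjects.incl_id a)
    fun x => by rw [star_comp_imIncl]⟩

/-- A cone which belongs to `H(γ; -)` at its apex factors through `γ`. -/
theorem exists_factor_of_mem_Hset {a b : C} {γ : NormalCone a} {σ : NormalCone b}
    (h : (⟨b, σ⟩ : TC C) ∈ Hset γ b) : ∃ k : a ⟶ b, ∀ x, σ.comp x = γ.comp x ≫ k := by
  obtain ⟨k, hk⟩ := h
  refine ⟨k, fun x => ?_⟩
  have := comp_eq_of_cone_eq hk (imIncl k) (𝟙 b) (imIncl_incl k)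
    (CategoryWithSubobjects.incl_id b) x
  rw [star_comp_imIncl, Category.comp_id] at this
  exact this.symm

/-- Every cone lies in its own H-functor, as σ * 1°, so equality of the functors places σ in H(γ; -)
and yields a factor. This is the converse of `H_eq_of`. -/
theorem exists_factor_of_H_eq {a b : C} {γ : NormalCone a} {σ : NormalCone b} (h : H γ = H σ) :
    ∃ k : a ⟶ b, ∀ x, σ.comp x = γ.comp x ≫ k := by
  refine exists_factor_of_mem_Hset ?_
  change _ ∈ (H γ).obj b
  rw [h]
  exact mem_Hset_self σ

/-- The two factors between the cones are mutually inverse, because a cone has an invertible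
component and can be cancelled on the left. Consequently the M-set, defined by an arbitrary cone
representing the functor, can be computed from any one of them. -/
theorem isIso_comp_of_H_eq {a b : C} {γ : NormalCone a} {σ : NormalCone b} (h : H γ = H σ)
    {c : C} (hc : IsIso (γ.comp c)) : IsIso (σ.comp c) := by
  obtain ⟨k, hk⟩ := exists_factor_of_H_eq h
  obtain ⟨l, hl⟩ := exists_factor_of_H_eq h.symm
  have : IsIso k := ⟨l, γ.cancel _ _ fun x => by
    rw [← Category.assoc, ← hk, ← hl, Category.comp_id], σ.cancel _ _ fun x => by
    rw [← Category.assoc, ← hl, ← hk, Category.comp_id]⟩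
  rw [hk]
  infer_instance

/-- Idempotency reads ε(x) ε(c) = ε(x) for all x once both cones are viewed in c, and the cone
cancels. -/
theorem comp_apex_of_isIdempotentElem {c : C} {ε : NormalCone c}
    (h : IsIdempotentElem (⟨c, ε⟩ : TC C)) : ε.comp c = 𝟙 c := by
  refine ε.cancel _ _ fun x => ?_
  have h' : (⟨_, star ε (ε.comp c)⟩ : TC C) = ⟨c, ε⟩ := h
  rw [← star_comp_imIncl]
  exact comp_eq_of_cone_eq h' (imIncl _) (𝟙 c) (imIncl_incl _)
    (CategoryWithSubobjects.incl_id c) x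

/-- Evaluating the factor from ε to σ at the common apex shows that it is the identity. This is the
uniqueness of γ(c, d), which makes the chosen `gammaCone` computable. -/
theorem cone_eq_of_H_eq {c : C} {ε σ : NormalCone c} (hε : ε.comp c = 𝟙 c)
    (hσ : σ.comp c = 𝟙 c) (h : H ε = H σ) : ε = σ := by
  obtain ⟨k, hk⟩ := exists_factor_of_H_eq h
  have hk' : k = 𝟙 c := by rw [← hσ, hk c, hε, Category.id_comp]
  refine NormalCone.ext (funext fun x => ?_)
  rw [hk x, hk', Category.comp_id]

theorem NormalDual.incl_comp {F G K : NormalDual C} (m : F ⟶ G) (n : G ⟶ K) (hm : incl m)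
    (hn : incl n) : incl (m ≫ n) := fun c x => (hn c (NormalDual.apply m c x)).trans (hm c x)

theorem NormalDual.incl_eqToHom {F G : NormalDual C} (h : F = G) : incl (eqToHom h) := by
  subst h
  exact fun _ _ => rfl

theorem NormalDual.mem_of_sub {F G : NormalDual C} (h : Sub F G) {c : C} {x : TC C}
    (hx : x ∈ F.fn.obj c) : x ∈ G.fn.obj c := by
  obtain ⟨m, hm⟩ := h
  have : (NormalDual.apply m c ⟨x, hx⟩ : TC C) = x := hm c ⟨x, hx⟩
  rw [← this]
  exact (NormalDual.apply m c ⟨x, hx⟩).2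

theorem NormalDual.eqToHom_nat {F G : NormalDual C} (h : F = G) :
    NormalDual.Hom.nat (eqToHom h) = eqToHom (congrArg (fun K => K.fn.toFunctor) h) := by
  subst h
  rfl

end

namespace TripleModel

/-! ### Principal cones and Green's relations. -/

section Cone

variable {S : Type u} [Semigroup S] {C : Type u} [Category.{u} C] [Inclusions C]
  [TripleModel S C]

theorem principalCone_comp_apex (e : Idem S) {c : C} (he : of e = c) :
    (principalCone e he).comp c = 𝟙 c := by
  rw [principalCone_comp e he e he, ← mor_id e he (between_self e), mor_eq_iff]

/-- If the component at `c` of `r^f` is invertible, then some `e ℛ f` represents `c`. -/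
theorem exists_idem_of_isIso_principalCone {f : Idem S} {d c : C} (hf : of f = d)
    (h : IsIso ((principalCone f hf).comp c)) :
    ∃ e : Idem S, of e = c ∧ (f : S) * e = e ∧ (e : S) * f = f := by
  obtain ⟨l, h₁, h₂⟩ := h
  obtain ⟨g, hg⟩ := of_surjective (S := S) c
  obtain ⟨v, hv, rfl⟩ := mor_surjective f g hf hg l
  obtain ⟨fv, vg⟩ := between_iff.1 hv
  rw [principalCone_comp f hf g hg] at h₁ h₂
  rw [mor_comp _ _ _ _ _ _ (between_comp (between_mul _ _) hv), ← mor_id g hg (between_self g),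
    mor_eq_iff, g.2, mul_assoc, fv] at h₁
  rw [mor_comp _ _ _ _ _ _ (between_comp hv (between_mul _ _)), ← mor_id f hf (between_self f),
    mor_eq_iff, f.2, ← mul_assoc, vg] at h₂
  -- The middle term v of the inverse is itself the required idempotent: f v = v and v f = f give v
  -- v = v, while v g = v and g v = g say v ℒ g.
  refine ⟨⟨v, ?_⟩, ?_, fv, h₂⟩
  · nth_rewrite 2 [← fv]
    rw [← mul_assoc, h₂, fv]
  · rw [← hg]
    exact of_eq_iff.2 ⟨vg, h₁⟩

/-- If `e, f ω^r h` and `r^f` factors through `r^e`, then `f ω^r e`. -/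
theorem mul_eq_of_principalCone_factor {e f h : Idem S} {c d : C} {he : of e = c} {hf : of f = d}
    (hhe : (h : S) * e = e) (hhf : (h : S) * f = f) (k : c ⟶ d)
    (hk : ∀ x, (principalCone f hf).comp x = (principalCone e he).comp x ≫ k) :
    (e : S) * f = f := by
  -- Evaluation at e identifies the middle term of the factor as e f. The cones see f and e f only
  -- after left multiplication by an idempotent g; taking g = h removes the multiplier. Without a
  -- common bound the conclusion fails: in a left zero semigroup all principal cones coincide.
  have key : ∀ g : Idem S, (g : S) * f = g * (e * f) := by
    intro g
    obtain ⟨w, hw, rfl⟩ := mor_surjective e f he hf k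
    have h₁ := hk (of e)
    have h₂ := hk (of g)
    rw [principalCone_comp _ _ e rfl, principalCone_comp _ _ e rfl,
      mor_comp _ _ _ _ _ _ (between_comp (between_mul _ _) hw), mor_eq_iff, e.2, ← mul_assoc, e.2,
      (between_iff.1 hw).1] at h₁
    rw [principalCone_comp _ _ g rfl, principalCone_comp _ _ g rfl,
      mor_comp _ _ _ _ _ _ (between_comp (between_mul _ _) hw), mor_eq_iff, ← mul_assoc,
      ← mul_assoc, g.2, mul_assoc, (between_iff.1 hw).1] at h₂
    rw [h₂, h₁]
  have := key h
  rw [hhf, ← mul_assoc, hhe] at this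
  exact this.symm

end Cone

/-! ### E_Γ, idempotent cones and commuting squares in terms of idempotents. -/

section Gamma

variable {S T : Type u} [Semigroup S] [Semigroup T] (φ : T ≃* Sᵐᵒᵖ)

theorem antiIdem_surjective : Function.Surjective (antiIdem φ) := fun e => by
  refine ⟨⟨φ.symm (MulOpposite.op e), ?_⟩, Subtype.ext ?_⟩
  · rw [← map_mul, ← MulOpposite.op_mul, e.2]
  · change (φ (φ.symm (MulOpposite.op (e : S)))).unop = e
    rw [MulEquiv.apply_symm_apply, MulOpposite.unop_op]

theorem anti_mul (s t : T) : (φ (s * t)).unop = (φ t).unop * (φ s).unop := by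
  rw [map_mul, MulOpposite.unop_mul]

theorem anti_injective : Function.Injective fun t : T => (φ t).unop :=
  MulOpposite.unop_injective.comp φ.injective

theorem coe_antiIdem (e : Idem T) : (antiIdem φ e : S) = (φ e).unop := rfl

/-- An anti-isomorphism exchanges ω^l and ω^r; this passes between the order on the objects of `D`
and the relation on principal cones in `C`. -/
theorem antiIdem_mul_eq_iff {e f : Idem T} :
    (antiIdem φ e : S) * antiIdem φ f = antiIdem φ f ↔ (f : T) * e = f := by
  simp only [coe_antiIdem, ← anti_mul]
  exact (anti_injective φ).eq_iff

theorem between_of_anti {e f : Idem T} {u : T}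
    (h : Between (antiIdem φ f) (φ u).unop (antiIdem φ e)) : Between e u f := by
  obtain ⟨h₁, h₂⟩ := between_iff.1 h
  rw [coe_antiIdem, ← anti_mul] at h₁ h₂
  exact between_iff.2 ⟨anti_injective φ h₂, anti_injective φ h₁⟩

variable {C D : Type u} [Category.{u} C] [Inclusions C] [NormalCategory C] [TripleModel S C]
  [Category.{u} D] [Inclusions D] [TripleModel T D]

theorem eGamma_gamma_of (e : Idem T) :
    EGamma (gamma φ C D) (of (antiIdem φ e)) (of e) := by
  refine ⟨_, principalCone (antiIdem φ e) rfl, gamma_obj φ C e, ?_⟩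
  rw [principalCone_comp_apex]
  infer_instance

/-- `E_Γ` consists of the pairs given by the idempotents. -/
theorem eGamma_gamma_iff {c : C} {d : D} :
    EGamma (gamma φ C D) c d ↔ ∃ e : Idem T, of (antiIdem φ e) = c ∧ of e = d := by
  constructor
  · rintro ⟨a, γ, hγ, hc⟩
    obtain ⟨f, rfl⟩ := of_surjective (S := T) d
    rw [gamma_obj φ C f] at hγ
    -- The cone witnessing membership in the M-set is traded for the principal cone with the same
    -- H-functor. The resulting idempotent is ℛ-related to the image of f, so its preimage in `T` is
    -- ℒ-related to f and represents the same object of `D`.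
    obtain ⟨e, he, h₁, h₂⟩ := exists_idem_of_isIso_principalCone rfl
      (isIso_comp_of_H_eq (congrArg NormalDual.fn hγ).symm hc)
    obtain ⟨e, rfl⟩ := antiIdem_surjective φ e
    exact ⟨e, he, of_eq_iff.2 ⟨(antiIdem_mul_eq_iff φ).1 h₁, (antiIdem_mul_eq_iff φ).1 h₂⟩⟩
  · rintro ⟨e, rfl, rfl⟩
    exact eGamma_gamma_of φ e

/-- Both cones are the identity at their apex and have H-functor Γ(d), so uniqueness applies. -/
theorem gammaCone_gamma (e : Idem T) {c : C} {d : D} (hc : of (antiIdem φ e) = c)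
    (hd : of e = d) (h : EGamma (gamma φ C D) c d) :
    gammaCone h = principalCone (antiIdem φ e) hc := by
  subst hc hd
  refine cone_eq_of_H_eq (comp_apex_of_isIdempotentElem (gammaCone_spec h).1)
    (principalCone_comp_apex _ _) ?_
  exact congrArg NormalDual.fn ((gammaCone_spec h).2.symm.trans (gamma_obj φ C e))

theorem etaGamma_gamma_hom (e : Idem T)
    (h : EGamma (gamma φ C D) (of (antiIdem φ e)) (of e)) :
    (etaGamma h).hom = NormalDual.Hom.nat (eqToHom (gamma_obj φ C e)) ≫
      (eta (principalCone (C := C) (antiIdem φ e) rfl)).hom := by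
  -- The chosen cone is generalized to a variable ε, so that its identification with the principal
  -- cone can be substituted although the equality of functors depends on it.
  have key : ∀ (ε : NormalCone (of (antiIdem φ e) : C))
      (h₁ : (gamma φ C D).obj (of e) = NormalDual.of ε)
      (_ : ε = principalCone (antiIdem φ e) rfl),
      eqToHom (congrArg (fun K => K.fn.toFunctor) h₁) ≫ (eta ε).hom =
        NormalDual.Hom.nat (eqToHom (gamma_obj φ C e)) ≫
          (eta (principalCone (C := C) (antiIdem φ e) rfl)).hom := by
    rintro _ h₁ rfl
    rw [NormalDual.eqToHom_nat]
  exact key _ (gammaCone_spec h).2 (gammaCone_gamma φ e rfl rfl h)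

/-- Γ sends (e, u, e') to C(r(e', u, e), -) conjugated by the isomorphisms η. These cancel against
the vertical sides of the square, leaving an equality of two maps of representable functors, and
Yoneda turns it into an equality of triples. Each pair must be represented by one idempotent on both
sides. -/
theorem commSquare_gamma_iff {e e' : Idem T} {c c' : C} {d d' : D} (hc : of (antiIdem φ e) = c)
    (hd : of e = d) (hc' : of (antiIdem φ e') = c') (hd' : of e' = d')
    (h : EGamma (gamma φ C D) c d) (h' : EGamma (gamma φ C D) c' d') {u : T} {w : S}
    (hu : Between e u e') (hw : Between (antiIdem φ e') w (antiIdem φ e)) :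
    CommSquare (gamma φ C D) h h' (mor e u e' hd hd' hu)
      (mor (antiIdem φ e') w (antiIdem φ e) hc' hc hw) ↔ w = (φ u).unop := by
  subst hc hd hc' hd'
  unfold CommSquare
  have hnat : ((gamma φ C D).map (mor e u e' rfl rfl hu)).nat =
      NormalDual.Hom.nat (eqToHom (gamma_obj φ C e)) ≫ (gammaMap φ C e u e' hu).nat ≫
        NormalDual.Hom.nat (eqToHom (gamma_obj φ C e').symm) :=
    congrArg NormalDual.Hom.nat (gamma_map φ C e u e' hu)
  rw [etaGamma_gamma_hom, etaGamma_gamma_hom, hnat]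
  simp only [NormalDual.eqToHom_nat, gammaMap, Category.assoc, eqToHom_trans_assoc,
    eqToHom_refl, Category.id_comp, Iso.inv_hom_id, Category.comp_id, cancel_epi]
  constructor
  · intro H
    have H' := Quiver.Hom.op_inj (coyoneda.map_injective H)
    rw [mor_eq_iff] at H'
    rw [H', (between_iff.1 hw).1]
  · rintro rfl
    rfl

/-! ### `Γ` is a cross-connection -/

/-- Since e ω^l f in `T`, the images satisfy f e = e in `S`, so r^f(a) r(f, e, e) = r^e(a). The
cones r^e * k° and r^f * (r(f, e, e) k)° therefore have the same components and coincide. -/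
theorem incl_gammaMap {e f : Idem T} (hb : Between e (e : T) f) :
    incl (gammaMap φ C e e f hb) := by
  rintro c ⟨_, k, rfl⟩
  refine (gammaMap_apply φ C e e f hb k _).trans ?_
  refine cone_ext _ _ (imIncl _) (imIncl _) (imIncl_incl _) (imIncl_incl _) fun a => ?_
  have h₁ : (antiIdem φ f : S) * (φ e).unop = (φ e).unop :=
    (antiIdem_mul_eq_iff φ).2 (between_iff.1 hb).2
  rw [star_comp_imIncl, star_comp_imIncl, ← Category.assoc]
  congr 1
  rw [principalCone_comp _ _ _ (of_rep a), principalCone_comp _ _ _ (of_rep a),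
    mor_comp _ _ _ _ _ _ (between_comp (between_mul _ _) (between_anti φ hb)), mor_eq_iff,
    mul_assoc, h₁, ← mul_assoc, (rep S a).2]
  rfl

theorem gammaMap_injective {e f : Idem T} {u v : T} {hu : Between e u f} {hv : Between e v f}
    (h : gammaMap φ C e u f hu = gammaMap φ C e v f hv) : u = v := by
  have h' := congrArg NormalDual.Hom.nat h
  simp only [gammaMap, cancel_epi, cancel_mono] at h'
  have H := Quiver.Hom.op_inj (coyoneda.map_injective h')
  rw [mor_eq_iff, (between_iff.1 (between_anti φ hv)).1] at H
  exact anti_injective φ H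

/-- Conjugating by η gives a map of representables, which by Yoneda comes from a morphism of `C`,
that is, from a triple; its middle term is pulled back along the anti-isomorphism. -/
theorem gammaMap_surjective {e f : Idem T} (m : gammaObj φ C e ⟶ gammaObj φ C f) :
    ∃ (u : T) (hu : Between e u f), gammaMap φ C e u f hu = m := by
  obtain ⟨k, hk⟩ := coyoneda.map_surjective
    ((eta (principalCone (C := C) (antiIdem φ e) rfl)).inv ≫ m.nat ≫
      (eta (principalCone (C := C) (antiIdem φ f) rfl)).hom)
  obtain ⟨w, hw, hkw⟩ := mor_surjective (antiIdem φ f) (antiIdem φ e) rfl rfl k.unop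
  obtain ⟨u, rfl⟩ : ∃ u : T, (φ u).unop = w :=
    ⟨φ.symm (MulOpposite.op w), by rw [MulEquiv.apply_symm_apply, MulOpposite.unop_op]⟩
  refine ⟨u, between_of_anti φ hw, NormalDual.Hom.ext ?_⟩
  simp only [gammaMap]
  rw [← hkw, Quiver.Hom.op_unop, hk]
  simp

theorem inclusionPreserving_gamma : InclusionPreserving (gamma φ C D) := by
  intro a b j hj
  obtain ⟨e, f, rfl, rfl, hb, rfl⟩ := (incl_iff (S := T) j).1 hj
  rw [gamma_map]
  exact NormalDual.incl_comp _ _ (NormalDual.incl_eqToHom _)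
    (NormalDual.incl_comp _ _ (incl_gammaMap φ hb) (NormalDual.incl_eqToHom _))

theorem faithful_gamma : (gamma φ C D).Faithful where
  map_injective {d d'} l m h := by
    obtain ⟨e, rfl⟩ := of_surjective (S := T) d
    obtain ⟨f, rfl⟩ := of_surjective (S := T) d'
    obtain ⟨u, hu, rfl⟩ := mor_surjective e f rfl rfl l
    obtain ⟨v, hv, rfl⟩ := mor_surjective e f rfl rfl m
    rw [gamma_map, gamma_map, cancel_epi, cancel_mono] at h
    obtain rfl := gammaMap_injective φ h
    rfl

theorem full_gamma : (gamma φ C D).Full where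
  map_surjective {d d'} m := by
    obtain ⟨e, rfl⟩ := of_surjective (S := T) d
    obtain ⟨f, rfl⟩ := of_surjective (S := T) d'
    obtain ⟨u, hu, h⟩ := gammaMap_surjective φ
      (eqToHom (gamma_obj φ C e).symm ≫ m ≫ eqToHom (gamma_obj φ C f))
    refine ⟨mor e u f rfl rfl hu, ?_⟩
    rw [gamma_map, h]
    simp

theorem sub_of_iff {e f : Idem T} : Sub (of e : D) (of f) ↔ (e : T) * f = e := by
  constructor
  · rintro ⟨j, hj⟩
    obtain ⟨g, h, hg, hh, hb, rfl⟩ := (incl_iff (S := T) j).1 hj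
    have hgf : (g : T) * f = g := by rw [← (between_iff.1 hb).2, mul_assoc, green hh rfl]
    rw [← green rfl hg, mul_assoc, hgf]
  · intro h
    have hb : Between e (e : T) f := between_iff.2 ⟨e.2, h⟩
    exact ⟨mor e e f rfl rfl hb, (incl_iff (S := T) _).2 ⟨e, f, rfl, rfl, hb, rfl⟩⟩

/-- A cone which factors through `r^h` has the H-functor of `r^e` for some `e ω^r h`. -/
theorem exists_idem_H_eq {h : Idem S} {c a : C} {hc : of h = c} {γ : NormalCone a} (k : c ⟶ a)
    (hk : ∀ x, γ.comp x = (principalCone h hc).comp x ≫ k) :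
    ∃ e : Idem S, (h : S) * e = e ∧ H γ = H (principalCone (C := C) e rfl) := by
  obtain ⟨f, hf⟩ := of_surjective (S := S) a
  obtain ⟨w, hw, rfl⟩ := mor_surjective h f hc hf k
  obtain ⟨hw₁, hw₂⟩ := between_iff.1 hw
  -- The cone γ is right translation by w; the task is to replace w by an idempotent ℛ-related to
  -- it.
  have hγ : ∀ (x : C) (g : Idem S) (hg : of g = x),
      γ.comp x = mor g (g * w) f hg hf (between_iff.2
        ⟨by rw [← mul_assoc, g.2], by rw [mul_assoc, hw₂]⟩) := by
    intro x g hg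
    rw [hk, principalCone_comp _ _ g hg,
      mor_comp _ _ _ _ _ _ (between_comp (between_mul _ _) hw), mor_eq_iff, mul_assoc, hw₁,
      ← mul_assoc, g.2]
  obtain ⟨b, l, h₁, h₂⟩ := γ.exists_iso
  obtain ⟨g, hg⟩ := of_surjective (S := S) b
  obtain ⟨v, hv, rfl⟩ := mor_surjective f g hf hg l
  obtain ⟨hv₁, hv₂⟩ := between_iff.1 hv
  rw [hγ b g hg, mor_comp _ _ _ _ _ _ (between_comp hv (between_iff.2
        ⟨by rw [← mul_assoc, g.2], by rw [mul_assoc, hw₂]⟩)),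
    ← mor_id f hf (between_self f), mor_eq_iff, f.2, ← mul_assoc, hv₂] at h₂
  -- Invertibility at b has given v w = f. Hence w v is idempotent and ℛ-related to w, and w, v give
  -- mutually inverse morphisms between e = w v and f, which carry γ to r^e and back.
  have he : w * v * (w * v) = w * v := by
    rw [mul_assoc, ← mul_assoc v, h₂, hv₁]
  have hew : w * v * w = w := by rw [mul_assoc, h₂, hw₂]
  have hve : v * (w * v) = v := by rw [← mul_assoc, h₂, hv₁]
  let e : Idem S := ⟨w * v, he⟩
  have bw : Between e w f := between_iff.2 ⟨hew, hw₂⟩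
  have bv : Between f v e := between_iff.2 ⟨hv₁, hve⟩
  refine ⟨e, ?_, H_eq_of _ _ (mor f v e hf rfl bv) (mor e w f rfl hf bw) (fun x => ?_)
    fun x => ?_⟩
  · change (h : S) * (w * v) = w * v
    rw [← mul_assoc, hw₁]
  · obtain ⟨p, hp⟩ := of_surjective (S := S) x
    rw [hγ x p hp, principalCone_comp _ _ p hp,
      mor_comp _ _ _ _ _ _ (between_comp (between_iff.2
        ⟨by rw [← mul_assoc, p.2], by rw [mul_assoc, hw₂]⟩) bv), mor_eq_iff]
    change (p : S) * (w * v) = p * (p * w * v)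
    simp only [← mul_assoc, p.2]
  · obtain ⟨p, hp⟩ := of_surjective (S := S) x
    rw [hγ x p hp, principalCone_comp _ _ p hp,
      mor_comp _ _ _ _ _ _ (between_comp (between_mul _ _) bw), mor_eq_iff]
    change (p : S) * w = p * (p * (w * v) * w)
    rw [mul_assoc (p : S) (w * v), hew, ← mul_assoc, p.2]

/-- On objects below h, the idempotents involved have h as a common ω^r-bound, which is what
injectivity needs. For surjectivity, a subfunctor H(γ; -) of H(r^h; -) contains γ itself, so γ
factors through r^h and has the H-functor of some r^e with e below h. -/
theorem ideal_bijOn_gamma (d : D) :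
    Set.BijOn (gamma φ C D).obj {d' | Sub d' d} {F | Sub F ((gamma φ C D).obj d)} := by
  obtain ⟨h, rfl⟩ := of_surjective (S := T) d
  refine ⟨?_, ?_, ?_⟩
  · rintro d' ⟨j, hj⟩
    exact ⟨_, inclusionPreserving_gamma φ j hj⟩
  · intro d₁ hd₁ d₂ hd₂ H
    obtain ⟨e, rfl⟩ := of_surjective (S := T) d₁
    obtain ⟨f, rfl⟩ := of_surjective (S := T) d₂
    have he := (antiIdem_mul_eq_iff φ).2 (sub_of_iff.1 hd₁)
    have hf := (antiIdem_mul_eq_iff φ).2 (sub_of_iff.1 hd₂)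
    rw [gamma_obj, gamma_obj] at H
    have H' := congrArg NormalDual.fn H
    obtain ⟨k, hk⟩ := exists_factor_of_H_eq H'
    obtain ⟨l, hl⟩ := exists_factor_of_H_eq H'.symm
    exact of_eq_iff.2
      ⟨(antiIdem_mul_eq_iff φ).1 (mul_eq_of_principalCone_factor hf he l hl),
        (antiIdem_mul_eq_iff φ).1 (mul_eq_of_principalCone_factor he hf k hk)⟩
  · rintro ⟨_, a, γ, rfl⟩ hF
    have hγ := NormalDual.mem_of_sub hF (mem_Hset_self γ)
    rw [gamma_obj] at hγ
    obtain ⟨k, hk⟩ := exists_factor_of_mem_Hset hγ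
    obtain ⟨e, he, H⟩ := exists_idem_H_eq k hk
    obtain ⟨e, rfl⟩ := antiIdem_surjective φ e
    exact ⟨of e, sub_of_iff.2 ((antiIdem_mul_eq_iff φ).1 he),
      (gamma_obj φ C e).trans (NormalDual.ext H.symm)⟩

theorem isCrossConnection_gamma : IsCrossConnection (gamma φ C D) where
  localIso := ⟨inclusionPreserving_gamma φ, full_gamma φ, faithful_gamma φ, ideal_bijOn_gamma φ⟩
  exists_mem c := by
    obtain ⟨e, rfl⟩ := of_surjective (S := S) c
    obtain ⟨e, rfl⟩ := antiIdem_surjective φ e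
    exact ⟨of e, eGamma_gamma_of φ e⟩

/-! ### The dual of `Γ` -/

section Dual

variable (ψ : S ≃* Tᵐᵒᵖ)

theorem antiIdem_antiIdem (hψ : ∀ t : T, (ψ (φ t).unop).unop = t) (e : Idem T) :
    antiIdem ψ (antiIdem φ e) = e :=
  Subtype.ext (hψ e)

/-- The squares of the two functors commute under w = φ(u) and u = ψ(w) respectively, which are
equivalent because the anti-isomorphisms are mutually inverse. The components of the cones match
because the product of e' and e in `T`, giving δ(c, d)(d'), is carried to the reversed product in
`S`, giving γ(c', d')(c). -/
theorem isDual_gamma [NormalCategory D] (hψ : ∀ t : T, (ψ (φ t).unop).unop = t) :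
    IsDual (gamma φ C D) (gamma ψ D C) where
  isCrossConnection := isCrossConnection_gamma ψ
  mem_iff c d := by
    rw [eGamma_gamma_iff, eGamma_gamma_iff]
    constructor
    · rintro ⟨e, h₁, h₂⟩
      obtain ⟨e, rfl⟩ := antiIdem_surjective φ e
      rw [antiIdem_antiIdem φ ψ hψ] at h₁
      exact ⟨e, h₂, h₁⟩
    · rintro ⟨e, h₁, h₂⟩
      exact ⟨antiIdem φ e, by rwa [antiIdem_antiIdem φ ψ hψ], h₁⟩
  square_iff {c c' d d'} h h' k k' f g := by
    obtain ⟨e, hc, hd⟩ := (eGamma_gamma_iff φ).1 h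
    obtain ⟨e', hc', hd'⟩ := (eGamma_gamma_iff φ).1 h'
    obtain ⟨w, hw, rfl⟩ := mor_surjective (antiIdem φ e) (antiIdem φ e') hc hc' f
    obtain ⟨u, hu, rfl⟩ := mor_surjective e' e hd' hd g
    rw [commSquare_gamma_iff φ hc' hd' hc hd h' h hu hw]
    -- Going back and forth between `T` and `S` returns e only up to a propositional equality.
    -- Stating the comparison for variables p, p' lets the dependent proofs in the triple be
    -- transported.
    have aux : ∀ (p p' : Idem T) (hp : p = e) (hp' : p' = e') (hp₁ : of p = d) (hp₂ : of p' = d')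
        (hu' : Between p' u p), mor p' u p hp₂ hp₁ hu' = mor e' u e hd' hd hu := by
      rintro p p' rfl rfl _ _ _
      rfl
    have ee := antiIdem_antiIdem φ ψ hψ e
    have ee' := antiIdem_antiIdem φ ψ hψ e'
    have hd₁ : of (antiIdem ψ (antiIdem φ e)) = d := by rwa [ee]
    have hd₂ : of (antiIdem ψ (antiIdem φ e')) = d' := by rwa [ee']
    have hu' : Between (antiIdem ψ (antiIdem φ e')) u (antiIdem ψ (antiIdem φ e)) := by
      rwa [ee, ee']
    rw [← aux _ _ ee ee' hd₁ hd₂ hu', commSquare_gamma_iff ψ hd₁ hc hd₂ hc' k k' hw hu']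
    constructor
    · intro H
      apply anti_injective ψ
      change (ψ w).unop = (ψ (φ u).unop).unop
      rw [← H, hψ]
    · rintro rfl
      rw [hψ]
  cone_comp {c c' d d'} h h' k := by
    obtain ⟨e, hc, hd⟩ := (eGamma_gamma_iff φ).1 h
    obtain ⟨e', hc', hd'⟩ := (eGamma_gamma_iff φ).1 h'
    have ee := antiIdem_antiIdem φ ψ hψ e
    have hd₁ : of (antiIdem ψ (antiIdem φ e)) = d := by rwa [ee]
    have aux : ∀ (p : Idem T) (hp : p = e) (hp₁ : of p = d),
        principalCone p hp₁ = principalCone e hd := by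
      rintro p rfl _
      rfl
    rw [gammaCone_gamma ψ (antiIdem φ e) hd₁ hc k, aux _ ee hd₁,
      gammaCone_gamma φ e' hc' hd' h', principalCone_comp _ _ _ hd', principalCone_comp _ _ _ hc,
      commSquare_gamma_iff φ hc' hd' hc hd h' h, anti_mul]
    rfl

end Dual

end Gamma

/-! ### Functors which respect the description by triples -/

section Functor

variable {S : Type u} [Semigroup S] {C C' C'' : Type u}
  [Category.{u} C] [Inclusions C] [TripleModel S C]
  [Category.{u} C'] [Inclusions C'] [TripleModel S C']
  [Category.{u} C''] [Inclusions C''] [TripleModel S C'']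

variable (S) in
/-- `F` maps the object given by `e` to the object given by `e`, and the morphism given by
`(e, u, f)` to the morphism given by `(e, u, f)`. -/
structure PreservesTriples (F : C ⥤ C') : Prop where
  obj_of : ∀ {c : C} {e : Idem S}, of e = c → of e = F.obj c
  map_mor : ∀ {c d : C} (e : Idem S) (u : S) (f : Idem S) (he : of e = c) (hf : of f = d)
    (hu : Between e u f), F.map (mor e u f he hf hu) = mor e u f (obj_of he) (obj_of hf) hu

theorem PreservesTriples.comp {F : C ⥤ C'} {G : C' ⥤ C''} (hF : PreservesTriples S F)
    (hG : PreservesTriples S G) : PreservesTriples S (F ⋙ G) where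
  obj_of he := hG.obj_of (hF.obj_of he)
  map_mor e u f he hf hu := by rw [Functor.comp_map, hF.map_mor, hG.map_mor]

variable (S C) in
theorem preservesTriples_id : PreservesTriples S (𝟭 C) where
  obj_of he := he
  map_mor _ _ _ _ _ _ := rfl

theorem mor_eqToHom_comp {c c' d d' : C} (hc : c' = c) (hd : d = d') {e f : Idem S} {u : S}
    (he : of e = c) (hf : of f = d) (hu : Between e u f) :
    eqToHom hc ≫ mor e u f he hf hu ≫ eqToHom hd =
      mor e u f (he.trans hc.symm) (hf.trans hd) hu := by
  subst hc hd
  simp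

/-- Every object and every morphism comes from idempotents and triples, so nothing is left to
choose. This later shows that composites with inverse candidates are identities. -/
theorem PreservesTriples.eq {F G : C ⥤ C'} (hF : PreservesTriples S F)
    (hG : PreservesTriples S G) : F = G := by
  have hobj : ∀ c, F.obj c = G.obj c := fun c =>
    (hF.obj_of (of_rep (S := S) c)).symm.trans (hG.obj_of (of_rep c))
  refine CategoryTheory.Functor.ext hobj fun c d m => ?_
  obtain ⟨u, hu, rfl⟩ := mor_surjective (rep S c) (rep S d) (of_rep c) (of_rep d) m
  rw [hF.map_mor, hG.map_mor, mor_eqToHom_comp]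

theorem PreservesTriples.inclusionPreserving {F : C ⥤ C'} (hF : PreservesTriples S F) :
    InclusionPreserving F := by
  intro a b j hj
  obtain ⟨e, f, he, hf, hb, rfl⟩ := (incl_iff (S := S) j).1 hj
  rw [hF.map_mor]
  exact (incl_iff (S := S) _).2 ⟨e, f, _, _, hb, rfl⟩

/-- Equality of objects, equality of morphisms and being an inclusion are decided by the same
conditions on triples in both models. -/
theorem PreservesTriples.isNormalCategoryIso {F : C ⥤ C'} (hF : PreservesTriples S F) :
    IsNormalCategoryIso F where
  obj_bijective := by
    constructor
    · intro c d h
      rw [← of_rep (S := S) c, ← of_rep (S := S) d]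
      refine of_eq_iff.2 (of_eq_iff.1 ((hF.obj_of (of_rep c)).trans ?_))
      rw [h, ← hF.obj_of (of_rep d)]
    · intro d
      obtain ⟨e, rfl⟩ := of_surjective (S := S) d
      exact ⟨of e, (hF.obj_of rfl).symm⟩
  full := ⟨fun {c d} m => by
    obtain ⟨u, hu, rfl⟩ := mor_surjective (rep S c) (rep S d) (hF.obj_of (of_rep c))
      (hF.obj_of (of_rep d)) m
    exact ⟨mor _ u _ (of_rep c) (of_rep d) hu, hF.map_mor _ _ _ _ _ _⟩⟩
  faithful := ⟨fun {c d} l m h => by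
    obtain ⟨u, hu, rfl⟩ := mor_surjective (rep S c) (rep S d) (of_rep c) (of_rep d) l
    obtain ⟨v, hv, rfl⟩ := mor_surjective (rep S c) (rep S d) (of_rep c) (of_rep d) m
    rw [hF.map_mor, hF.map_mor, mor_eq_iff] at h
    exact (mor_eq_iff _ _ _ _ _ _).2 h⟩
  incl_iff {a b} j := by
    refine ⟨fun h => ?_, hF.inclusionPreserving j⟩
    obtain ⟨e, f, he, hf, hb, hj⟩ := (incl_iff (S := S) _).1 h
    obtain ⟨u, hu, rfl⟩ := mor_surjective (rep S a) (rep S b) (of_rep a) (of_rep b) j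
    rw [hF.map_mor, mor_eq_iff] at hj
    -- The representative of a and e give the same object of `C'`, hence are ℒ-related. So the
    -- middle term of j over chosen representatives equals its first term, and j is an inclusion
    -- already in `C`.
    have hre : (rep S a : S) * e = rep S a := green (hF.obj_of (of_rep a)) he
    rw [hre] at hj
    subst hj
    exact (incl_iff (S := S) _).2 ⟨_, _, _, _, hu, rfl⟩

theorem PreservesTriples.map_principalCone {F : C ⥤ C'} (hF : PreservesTriples S F) (e : Idem S)
    {c : C} (he : of e = c) (a : C) :
    F.map ((principalCone e he).comp a) = (principalCone e (hF.obj_of he)).comp (F.obj a) := by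
  rw [principalCone_comp _ _ _ (of_rep a),
    principalCone_comp _ _ _ (hF.obj_of (of_rep a)), hF.map_mor]

/-- A morphism of `C` has a counterpart in `C'`, given by the same triples. -/
theorem exists_corresponding {c d : C} {c' d' : C'} (hc : of (rep S c) = c')
    (hd : of (rep S d) = d') (m : c ⟶ d) :
    ∃ m' : c' ⟶ d', ∀ (e : Idem S) (u : S) (f : Idem S) (he : of e = c) (hf : of f = d)
      (hu : Between e u f) (he' : of e = c') (hf' : of f = d'), m = mor e u f he hf hu →
      m' = mor e u f he' hf' hu := by
  obtain ⟨v, hv, rfl⟩ := mor_surjective (rep S c) (rep S d) (of_rep c) (of_rep d) m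
  refine ⟨mor _ v _ hc hd hv, fun e u f he hf hu he' hf' h => ?_⟩
  rw [mor_eq_iff] at h ⊢
  exact h

variable (S C C') in
-- The assignment (e, u, f) ↦ (e, u, f) is well defined because both models identify triples by the
-- same criterion u = e v. Applied in the opposite direction it supplies the inverse morphism of
-- cross-connections.
theorem exists_preservesTriples : ∃ F : C ⥤ C', PreservesTriples S F := by
  choose k hk using fun (c d : C) (m : c ⟶ d) =>
    exists_corresponding (S := S) (C' := C') (rfl : of (rep S c) = _) (rfl : of (rep S d) = _) m
  have hof : ∀ {c : C} {e : Idem S}, of e = c → (of e : C') = of (rep S c) := fun {c e} he =>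
    of_eq_iff.2 (of_eq_iff.1 (he.trans (of_rep c).symm))
  let F : C ⥤ C' :=
    { obj := fun c => of (rep S c)
      map := fun {c d} m => k c d m
      map_id := fun c => by
        rw [hk c c (𝟙 c) _ _ _ (of_rep c) (of_rep c) (between_self _) rfl rfl
          (mor_id _ _ _).symm, mor_id]
      map_comp := fun {a b c} l m => by
        obtain ⟨u, hu, hl⟩ := mor_surjective (rep S a) (rep S b) (of_rep a) (of_rep b) l
        obtain ⟨v, hv, hm⟩ := mor_surjective (rep S b) (rep S c) (of_rep b) (of_rep c) m
        rw [hk a b l _ _ _ _ _ hu rfl rfl hl, hk b c m _ _ _ _ _ hv rfl rfl hm,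
          mor_comp _ _ _ _ _ _ (between_comp hu hv)]
        refine hk a c _ _ _ _ (of_rep a) (of_rep c) _ _ _ ?_
        rw [hl, hm, mor_comp] }
  exact ⟨F, hof, fun e u f he hf hu => hk _ _ _ e u f he hf hu _ _ rfl⟩

end Functor

/-! ### Morphisms of cross-connections -/

section Morphism

variable {S T : Type u} [Semigroup S] [Semigroup T] (φ : T ≃* Sᵐᵒᵖ) (ψ : S ≃* Tᵐᵒᵖ)
  {C C' D D' : Type u}
  [Category.{u} C] [Inclusions C] [NormalCategory C] [TripleModel S C]
  [Category.{u} C'] [Inclusions C'] [NormalCategory C'] [TripleModel S C']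
  [Category.{u} D] [Inclusions D] [TripleModel T D]
  [Category.{u} D'] [Inclusions D'] [TripleModel T D']

theorem PreservesTriples.eGamma {F : C ⥤ C'} {G : D ⥤ D'} (hF : PreservesTriples S F)
    (hG : PreservesTriples T G) {c : C} {d : D} (h : EGamma (gamma φ C D) c d) :
    EGamma (gamma φ C' D') (F.obj c) (G.obj d) := by
  obtain ⟨e, hc, hd⟩ := (eGamma_gamma_iff φ).1 h
  exact (eGamma_gamma_iff φ).2 ⟨e, hF.obj_of hc, hG.obj_of hd⟩

variable [NormalCategory D] [NormalCategory D']

/-- E_Γ, its idempotent cones and the transposes are all described by idempotents and triples, in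
formulas which do not mention the model. Both (M1) and (M2) thus compare identical conditions. -/
theorem PreservesTriples.isCrossConnectionMorphism {F : C ⥤ C'} {G : D ⥤ D'}
    (hF : PreservesTriples S F) (hG : PreservesTriples T G) :
    IsCrossConnectionMorphism (gamma φ C D) (gamma ψ D C) (gamma φ C' D') (gamma ψ D' C') F G where
  inclusionPreserving_left := hF.inclusionPreserving
  inclusionPreserving_right := hG.inclusionPreserving
  map_mem h := hF.eGamma φ hG h
  map_cone {c d} h c' := by
    obtain ⟨e, hc, hd⟩ := (eGamma_gamma_iff φ).1 h
    rw [gammaCone_gamma φ e hc hd, gammaCone_gamma φ e (hF.obj_of hc) (hG.obj_of hd),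
      hF.map_principalCone]
  map_transpose {c c' d d'} _ _ f g := by
    rintro ⟨k, k', h⟩
    refine ⟨hG.eGamma ψ hF k, hG.eGamma ψ hF k', ?_⟩
    -- The square belongs to Δ, so the idempotents are taken from E_Δ; each represents both members
    -- of its pair, as the criterion for commuting squares requires.
    obtain ⟨e, hd, hc⟩ := (eGamma_gamma_iff ψ).1 k
    obtain ⟨e', hd', hc'⟩ := (eGamma_gamma_iff ψ).1 k'
    obtain ⟨u, hu, rfl⟩ := mor_surjective e e' hc hc' f
    obtain ⟨w, hw, rfl⟩ := mor_surjective (antiIdem ψ e') (antiIdem ψ e) hd' hd g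
    rw [commSquare_gamma_iff ψ hd hc hd' hc' k k' hu hw] at h
    rw [hF.map_mor, hG.map_mor,
      commSquare_gamma_iff ψ (hG.obj_of hd) (hF.obj_of hc) (hG.obj_of hd') (hF.obj_of hc')]
    exact h

theorem PreservesTriples.isCrossConnectionIso {F : C ⥤ C'} {G : D ⥤ D'}
    (hF : PreservesTriples S F) (hG : PreservesTriples T G) :
    IsCrossConnectionIso (gamma φ C D) (gamma ψ D C) (gamma φ C' D') (gamma ψ D' C') F G := by
  obtain ⟨F', hF'⟩ := exists_preservesTriples S C' C
  obtain ⟨G', hG'⟩ := exists_preservesTriples T D' D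
  exact ⟨hF.isCrossConnectionMorphism φ ψ hG, F', G', hF'.isCrossConnectionMorphism φ ψ hG',
    (hF.comp hF').eq (preservesTriples_id S C), (hF'.comp hF).eq (preservesTriples_id S C'),
    (hG.comp hG').eq (preservesTriples_id T D), (hG'.comp hG).eq (preservesTriples_id T D')⟩

end Morphism

end TripleModel

/-! ### The functor 𝔏 preserves triples; the main theorem. -/

theorem preservesTriples_functorL (S : Type u) [Semigroup S] [IsRegularSemigroup S] :
    TripleModel.PreservesTriples S (functorL S) where
  obj_of he := by
    subst he
    rfl
  map_mor e u f he hf hu := by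
    subst he hf
    exact functorL_map_r e u f hu

end CrossConn

theorem mainTheorem2 (S : Type u) [Semigroup S] [CrossConn.IsRegularSemigroup S] :
    -- the four categories are normal categories
    CrossConn.NormalCategory (CrossConn.LG S) ∧ CrossConn.NormalCategory (CrossConn.RG S) ∧
    CrossConn.NormalCategory (CrossConn.LS S) ∧ CrossConn.NormalCategory (CrossConn.RS S) ∧
    -- `Γ_G` and `Γ_S` are cross-connections, with duals `Δ_G` and `Δ_S`
    CrossConn.IsCrossConnection (CrossConn.GammaG S) ∧
    CrossConn.IsDual (CrossConn.GammaG S) (CrossConn.DeltaG S) ∧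
    CrossConn.IsCrossConnection (CrossConn.GammaS S) ∧
    CrossConn.IsDual (CrossConn.GammaS S) (CrossConn.DeltaS S) ∧
    -- `𝔏` and `ℜ` are isomorphisms of normal categories
    CrossConn.IsNormalCategoryIso (CrossConn.functorL S) ∧
    CrossConn.IsNormalCategoryIso (CrossConn.functorR S) ∧
    -- `(𝔏, ℜ)` is an isomorphism of cross-connections
    CrossConn.IsCrossConnectionIso (CrossConn.GammaG S) (CrossConn.DeltaG S)
      (CrossConn.GammaS S) (CrossConn.DeltaS S) (CrossConn.functorL S) (CrossConn.functorR S) := by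
  have hL := CrossConn.preservesTriples_functorL S
  have hR := CrossConn.preservesTriples_functorL Sᵐᵒᵖ
  -- For Γ and Δ the anti-isomorphisms are the identity of the opposite semigroup and the passage to
  -- the double opposite. They are inverse to each other by definition, which is why `rfl` proves
  -- the condition for duality.
  exact ⟨inferInstance, inferInstance, inferInstance, inferInstance,
    CrossConn.TripleModel.isCrossConnection_gamma _,
    CrossConn.TripleModel.isDual_gamma _ _ fun _ => rfl,
    CrossConn.TripleModel.isCrossConnection_gamma _,
    CrossConn.TripleModel.isDual_gamma _ _ fun _ => rfl,
    hL.isNormalCategoryIso, hR.isNormalCategoryIso, hL.isCrossConnectionIso _ _ hR⟩
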